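/- Let $k\ge 2$ and let $2\le d_1\le d_2\le\cdots\le d_k$ be integers. Consider the $k$-partite quantum system with Hilbert space $\mathcal H=\mathcal H_1\otimes\cdots\otimes\mathcal H_k$, $\dim\mathcal H_i=d_i$, and let $\mathcal W$ be the set of its mixed states, i.e. of the positive semidefinite Hermitian operators of trace $1$ on $\mathcal H$. The group of local unitary transformations $G=\mathrm U(d_1)\otimes\cdots\otimes\mathrm U(d_k)=\{U_1\otimes\cdots\otimes U_k : U_i\in\mathrm U(d_i)\}$ acts on $\mathcal W$ by $(g,W)\mapsto gWg^\dagger$; every orbit is an embedded smooth submanifold of the real vector space of operators on $\mathcal H$. Then: 1. The maximum dimension of the $G$-orbits in $\mathcal W$ is equal to $d_1^2+\cdots+d_k^2-k$. 2. The minimal isotropy subgroup is the center of $G$: the center of $G$ is contained in the isotropy subgroup of every $W\in\mathcal W$, and it is equal to the isotropy subgroup of some $W\in\mathcal W$. 3. Call the orbit of $W\in\mathcal W$ generic (of principal type) if the isotropy subgroup of $W$ is, up to conjugacy in $G$, contained in the isotropy subgroup of every state. Every generic orbit is diffeomorphic to the product manifold $$\mathrm{SU}(d_1)/Z_{d_1}\times\mathrm{SU}(d_2)/Z_{d_2}\times\cdots\times\mathrm{SU}(d_k)/Z_{d_k},$$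 where $Z_{d_i}$, a cyclic group of order $d_i$, is the center of $\mathrm{SU}(d_i)$. -/

import Mathlib

open scoped ComplexOrder ContDiff Manifold Matrix.Norms.L2Operator

noncomputable section

namespace LocalUnitary

/-! ### The multipartite system

The `i`-th party has the Hilbert space `ℂ ^ (d i)`.  The product vectors of the standard bases form
an orthonormal basis of the tensor product `H = ⨂ i, ℂ ^ (d i)`, indexed by the multi-indices
`a : ∀ i, Fin (d i)`; operators on `H` are matrices with respect to this basis. -/

/-- The index set of the product basis of `⨂ i, ℂ ^ (d i)`. -/
abbrev Idx {k : ℕ} (d : Fin k → ℕ) : Type := ∀ i, Fin (d i)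

/-- The tensor product `A₁ ⊗ A₂ ⊗ ⋯ ⊗ A_k` of operators, in the product basis. -/
def tensor {k : ℕ} {d : Fin k → ℕ} (A : ∀ i, Matrix (Fin (d i)) (Fin (d i)) ℂ) :
    Matrix (Idx d) (Idx d) ℂ :=
  Matrix.of fun a b => ∏ i, A i (a i) (b i)

theorem tensor_mul {k : ℕ} {d : Fin k → ℕ} (A B : ∀ i, Matrix (Fin (d i)) (Fin (d i)) ℂ) :
    tensor (fun i => A i * B i) = tensor A * tensor B := by
  ext a b
  simp only [tensor, Matrix.of_apply, Matrix.mul_apply, Finset.prod_univ_sum,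
    Fintype.piFinset_univ, Finset.prod_mul_distrib]

theorem tensor_one {k : ℕ} {d : Fin k → ℕ} :
    tensor (fun i => (1 : Matrix (Fin (d i)) (Fin (d i)) ℂ)) = 1 := by
  ext a b
  simp only [tensor, Matrix.of_apply, Matrix.one_apply]
  rw [Finset.prod_ite_zero]
  simp [funext_iff]

theorem tensor_star {k : ℕ} {d : Fin k → ℕ} (A : ∀ i, Matrix (Fin (d i)) (Fin (d i)) ℂ) :
    tensor (fun i => star (A i)) = star (tensor A) := by
  ext a b
  simp [tensor, Matrix.star_apply]

/-- The homomorphism `(U₁, …, U_k) ↦ U₁ ⊗ ⋯ ⊗ U_k` from `∏ i, U(d i)` to the unitary group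
of `H`. -/
def tensorHom {k : ℕ} (d : Fin k → ℕ) :
    (∀ i, Matrix.unitaryGroup (Fin (d i)) ℂ) →* Matrix.unitaryGroup (Idx d) ℂ where
  toFun U := ⟨tensor fun i => (U i : Matrix (Fin (d i)) (Fin (d i)) ℂ), by
    rw [Matrix.mem_unitaryGroup_iff, ← tensor_star, ← tensor_mul, ← tensor_one]
    congr 1
    funext i
    exact Matrix.mem_unitaryGroup_iff.1 (U i).2⟩
  map_one' := Subtype.ext tensor_one
  map_mul' U V := Subtype.ext (tensor_mul _ _)

/-- The group `U(d₁) ⊗ ⋯ ⊗ U(d_k)` of local unitary transformations of `H`. -/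
def localUnitaryGroup {k : ℕ} (d : Fin k → ℕ) : Subgroup (Matrix.unitaryGroup (Idx d) ℂ) :=
  (tensorHom d).range

/-- The set of (mixed) states: positive semidefinite operators on `H` of trace one. -/
def State {k : ℕ} (d : Fin k → ℕ) : Type :=
  {W : Matrix (Idx d) (Idx d) ℂ // W.PosSemidef ∧ W.trace = 1}

/-- The operator (matrix) underlying a state. -/
def State.op {k : ℕ} {d : Fin k → ℕ} (W : State d) : Matrix (Idx d) (Idx d) ℂ := W.1

instance {k : ℕ} (d : Fin k → ℕ) : TopologicalSpace (State d) :=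
  TopologicalSpace.induced State.op inferInstance

/-- The action `(g, W) ↦ g W g†` of the local unitary group on the set of states. -/
instance {k : ℕ} (d : Fin k → ℕ) : MulAction (localUnitaryGroup d) (State d) where
  smul g W := ⟨(g.1.1 : Matrix (Idx d) (Idx d) ℂ) * W.1 * star g.1.1,
    W.2.1.mul_mul_conjTranspose_same _, by
      rw [Matrix.trace_mul_comm, ← mul_assoc, Matrix.mem_unitaryGroup_iff'.1 g.1.2, one_mul]
      exact W.2.2⟩
  one_smul W := Subtype.ext (by
    change (1 : Matrix (Idx d) (Idx d) ℂ) * W.1 * star (1 : Matrix (Idx d) (Idx d) ℂ) = W.1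
    simp)
  mul_smul g h W := Subtype.ext (by
    change (g.1.1 * h.1.1) * W.1 * star (g.1.1 * h.1.1)
      = g.1.1 * (h.1.1 * W.1 * star h.1.1) * star g.1.1
    simp only [star_mul, mul_assoc])

theorem smul_op {k : ℕ} {d : Fin k → ℕ} (g : localUnitaryGroup d) (W : State d) :
    (g • W).op = (g.1.1 : Matrix (Idx d) (Idx d) ℂ) * W.op * star g.1.1 := rfl

/-- The orbit of `W` under local unitary transformations. -/
abbrev Orbit {k : ℕ} {d : Fin k → ℕ} (W : State d) : Type :=
  MulAction.orbit (localUnitaryGroup d) W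

/-- The inclusion of an orbit into the space of operators on `H`. -/
def orbitIncl {k : ℕ} {d : Fin k → ℕ} (W : State d) : Orbit W → Matrix (Idx d) (Idx d) ℂ :=
  fun x => x.1.op

/-- `W` has a generic orbit (an orbit of principal type): its isotropy subgroup is, up to
conjugacy, contained in the isotropy subgroup of every state. -/
def IsGeneric {k : ℕ} {d : Fin k → ℕ} (W : State d) : Prop :=
  ∀ V : State d, ∃ g : localUnitaryGroup d,
    (MulAction.stabilizer (localUnitaryGroup d) W).map (MulAut.conj g).toMonoidHom ≤
      MulAction.stabilizer (localUnitaryGroup d) V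

/-! ### Smooth structures -/

/-- A structure of a smooth (`C^∞`) real `n`-dimensional manifold on a topological space. -/
structure SmoothStructure (n : ℕ) (X : Type) [TopologicalSpace X] where
  charted : ChartedSpace (EuclideanSpace ℝ (Fin n)) X
  isManifold : IsManifold (𝓡 n) ∞ X

/-- The smooth structure `s` makes `f : X → E` a smooth embedding, so that it is the smooth
structure of an embedded submanifold of `E` (it is determined by this up to equality of maximal
atlases). -/
def SmoothStructure.IsEmbedded {n : ℕ} {X : Type} [TopologicalSpace X] (s : SmoothStructure n X)
    {E : Type} [NormedAddCommGroup E] [NormedSpace ℝ E] (f : X → E) : Prop :=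
  letI := s.charted
  Manifold.IsSmoothEmbedding (𝓡 n) 𝓘(ℝ, E) ∞ f

/-- The smooth structures `s` on `X` and `t` on `Y` make `f : X → Y` a local diffeomorphism; for a
surjective `f`, this determines `t` in terms of `s` (up to equality of maximal atlases). -/
def SmoothStructure.IsLocalDiffeo {n : ℕ} {X Y : Type} [TopologicalSpace X] [TopologicalSpace Y]
    (s : SmoothStructure n X) (t : SmoothStructure n Y) (f : X → Y) : Prop :=
  letI := s.charted
  letI := t.charted
  IsLocalDiffeomorph (𝓡 n) (𝓡 n) ∞ f

/-- The manifold `X` is diffeomorphic to the product manifold `∏ i, Y i`. -/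
def DiffeomorphicToProd {n : ℕ} {X : Type} [TopologicalSpace X] (s : SmoothStructure n X)
    {k : ℕ} {m : Fin k → ℕ} {Y : Fin k → Type} [∀ i, TopologicalSpace (Y i)]
    (t : ∀ i, SmoothStructure (m i) (Y i)) : Prop :=
  letI := s.charted
  letI := fun i => (t i).charted
  Nonempty (Diffeomorph (𝓡 n)
    (ModelWithCorners.pi fun i => 𝓡 (m i)) X (∀ i, Y i) ∞)

/-- The orbit of `W` is an embedded smooth submanifold of dimension `n` of the real vector space of
operators on `H`. -/
def OrbitHasDim {k : ℕ} {d : Fin k → ℕ} (W : State d) (n : ℕ) : Prop :=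
  ∃ s : SmoothStructure n (Orbit W), s.IsEmbedded (orbitIncl W)

/-! ### The groups `SU(n)` and `SU(n) / Z_n` -/

/-- The special unitary group `SU(n)`, with the topology of a set of matrices. -/
abbrev SU (n : ℕ) : Type := Matrix.specialUnitaryGroup (Fin n) ℂ

/-- The quotient `SU(n) / Z_n` of the special unitary group by its center `Z_n`, with the quotient
topology. -/
abbrev PSU (n : ℕ) : Type := SU n ⧸ Subgroup.center (SU n)

/-- `t` is the quotient manifold structure on `SU(n) / Z_n`: the projection from `SU(n)`, with its
structure of an embedded submanifold of the space of matrices, is a local diffeomorphism. -/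
def IsQuotientStructure {n m : ℕ} (t : SmoothStructure m (PSU n)) : Prop :=
  ∃ s : SmoothStructure m (SU n),
    s.IsEmbedded (fun U : SU n => (U : Matrix (Fin n) (Fin n) ℂ)) ∧
      s.IsLocalDiffeo t (QuotientGroup.mk : SU n → PSU n)

end LocalUnitary

end

/-! Scalars act trivially under conjugation, so every orbit is already an orbit of the compact group
`∏ i, SU (d i)` (`pi_isPretransitive`). Schur's lemma shows that the center of the local unitary
group consists of scalars, so it fixes every state. It is the full isotropy group of a suitable
state: a normalized positive shift of `witnessOp`. The partial traces of `witnessOp` onto single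
parties have simple spectrum, which forces a commuting local unitary to be diagonal; its product
term has no zeros off the diagonal, which then forces each factor to be scalar. Since the center is
normal, generic means that the isotropy group is the center (`isGeneric_iff`), and a generic orbit
is in bijection with `∏ i, SU (d i) / Z_{d i}`.

The smooth statements are reduced to local parametrizations `IsParamAt`: maps from a vector space
that carry neighborhoods of `0` to neighborhoods of a point and are immersive at `0` in an ambient
space. By the inverse function theorem each is a slice of an ambient chart, so a family of them
gives an embedded smooth structure (`exists_smoothStructure`). `SU(n)`, its quotient and the generic
orbits all receive the coordinates `A ↦ exp A · x`. The maps between them are equivariant, hence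
linear in these coordinates, and smoothness needs no further computation.

Orbit maps are open because the group is compact (`map_smul_nhds`). A direction killed by the
derivative of an orbit map generates a one-parameter group fixing the point
(`orbitExp_eq_of_fderiv_eq_zero`). On a generic orbit this group is central, and a scalar matrix of
trace zero vanishes, so all `∑ (d i ^ 2 - 1)` directions survive. On an arbitrary orbit, the
exponential coordinates are restricted to a complement of the kernel, so the dimension can only
drop; `SmoothStructure.IsEmbedded.le_finrank` makes the bound hold for every embedded structure. -/

noncomputable section

namespace LocalUnitary

open Set Filter Topology Module

/-! ### Parametrized embedded submanifolds -/

section Param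

variable {V N E X : Type*} [NormedAddCommGroup V] [NormedSpace ℝ V]
  [NormedAddCommGroup N] [NormedSpace ℝ N]
  [NormedAddCommGroup E] [NormedSpace ℝ E]
  [TopologicalSpace X]

/-- `q` is a local parametrization at `x` of the space `X`, embedded in `E` by `f`. -/
structure IsParamAt (f : X → E) (q : V → X) (x : X) : Prop where
  map_nhds : map q (𝓝 0) = 𝓝 x
  apply_zero : q 0 = x
  contDiff : ContDiff ℝ ω (f ∘ q)
  injective : Function.Injective (fderiv ℝ (f ∘ q) 0)

theorem IsParamAt.comp_equiv {V' : Type*} [NormedAddCommGroup V'] [NormedSpace ℝ V']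
    {f : X → E} {q : V → X} {x : X} (hq : IsParamAt f q x) (L : V' ≃L[ℝ] V) :
    IsParamAt f (q ∘ L) x where
  map_nhds := by
    rw [← Filter.map_map, L.map_nhds_eq, map_zero, hq.map_nhds]
  apply_zero := by simp [hq.apply_zero]
  contDiff := hq.contDiff.comp L.contDiff
  injective := by
    rw [← Function.comp_assoc, L.comp_right_fderiv, map_zero]
    exact hq.injective.comp L.injective

theorem IsParamAt.smul {f : X → E} {q : V → X} {x : X} (hq : IsParamAt f q x)
    (e : X ≃ₜ X) (T : E ≃L[ℝ] E) (h : ∀ z, f (e z) = T (f z)) : IsParamAt f (e ∘ q) (e x) where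
  map_nhds := by rw [← Filter.map_map, hq.map_nhds, e.map_nhds_eq]
  apply_zero := by simp [hq.apply_zero]
  contDiff := by
    have : f ∘ e ∘ q = T ∘ f ∘ q := by ext1 v; exact h _
    rw [this]
    exact T.contDiff.comp hq.contDiff
  injective := by
    have : f ∘ e ∘ q = T ∘ f ∘ q := by ext1 v; exact h _
    rw [this, T.comp_fderiv]
    exact T.injective.comp hq.injective

variable [FiniteDimensional ℝ V] [FiniteDimensional ℝ N] [FiniteDimensional ℝ E]

/-- A smooth map with injective derivative at `0` extends to a local diffeomorphism. -/
theorem exists_slice {p : V → E} (hp : ContDiff ℝ ω p) (hinj : Function.Injective (fderiv ℝ p 0))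
    (hdim : finrank ℝ V + finrank ℝ N = finrank ℝ E) :
    ∃ Ψ : OpenPartialHomeomorph (V × N) E, (0 : V × N) ∈ Ψ.source ∧ (∀ v, Ψ (v, 0) = p v) ∧
      ContDiffOn ℝ ω Ψ Ψ.source ∧ ContDiffOn ℝ ω Ψ.symm Ψ.target := by
  -- `N` is identified with a complement `C` of the tangent space; `(v, w) ↦ p v + L w` then has
  -- invertible derivative at `0`.
  obtain ⟨C, hC⟩ := Submodule.exists_isCompl (fderiv ℝ p 0).toLinearMap.range
  have hrange : finrank ℝ (fderiv ℝ p 0).toLinearMap.range = finrank ℝ V :=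
    LinearMap.finrank_range_of_inj hinj
  have hsum := Submodule.finrank_add_eq_of_isCompl hC
  have hNC : finrank ℝ N = finrank ℝ C := by omega
  let L : N →L[ℝ] E :=
    (C.subtype ∘ₗ (LinearEquiv.ofFinrankEq N C hNC).toLinearMap).toContinuousLinearMap
  have hLinj : Function.Injective L := by
    change Function.Injective (C.subtype ∘ (LinearEquiv.ofFinrankEq N C hNC))
    exact C.subtype_injective.comp (LinearEquiv.injective _)
  have hLmem : ∀ x, L x ∈ C := fun x => (LinearEquiv.ofFinrankEq N C hNC x).2
  let D : V × N →L[ℝ] E := (fderiv ℝ p 0).coprod L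
  have hDinj : Function.Injective D := by
    rw [injective_iff_map_eq_zero]
    rintro ⟨v, w⟩ h
    have h1 : fderiv ℝ p 0 v + L w = 0 := by simpa [D] using h
    have h2 : fderiv ℝ p 0 v ∈ C := by
      rw [eq_neg_of_add_eq_zero_left h1]
      exact C.neg_mem (hLmem w)
    have h3 : fderiv ℝ p 0 v = 0 :=
      (Submodule.disjoint_def.1 hC.disjoint) _ ⟨v, rfl⟩ h2
    have h4 : L w = 0 := by rwa [h3, zero_add] at h1
    rw [Prod.mk_eq_zero]
    exact ⟨(injective_iff_map_eq_zero _).1 hinj _ h3, (injective_iff_map_eq_zero _).1 hLinj _ h4⟩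
  let De : (V × N) ≃L[ℝ] E := (LinearEquiv.ofInjectiveOfFinrankEq D.toLinearMap hDinj
    (by rw [finrank_prod, hdim])).toContinuousLinearEquiv
  have hDe : (De : V × N →L[ℝ] E) = D := by ext <;> rfl
  let P : V × N → E := fun z => p z.1 + L z.2
  have hP : ContDiff ℝ ω P := (hp.comp contDiff_fst).add (L.contDiff.comp contDiff_snd)
  have hPD : HasFDerivAt P (De : V × N →L[ℝ] E) 0 := by
    have hD : D = fderiv ℝ p 0 ∘SL ContinuousLinearMap.fst ℝ V N +
        L ∘SL ContinuousLinearMap.snd ℝ V N := by ext <;> simp [D]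
    rw [hDe, hD]
    have h1 : HasFDerivAt p (fderiv ℝ p 0) ((0 : V × N).1) :=
      (hp.differentiable (by simp) 0).hasFDerivAt
    exact (h1.comp (0 : V × N) hasFDerivAt_fst).add
      (L.hasFDerivAt.comp (0 : V × N) hasFDerivAt_snd)
  let Φ := hP.contDiffAt.toOpenPartialHomeomorph P hPD (by simp)
  have hΦ : (Φ : V × N → E) = P := hP.contDiffAt.toOpenPartialHomeomorph_coe hPD (by simp)
  have h0 : (0 : V × N) ∈ Φ.source := hP.contDiffAt.mem_toOpenPartialHomeomorph_source hPD (by simp)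
  have hsymm : ContDiffAt ℝ ω Φ.symm (Φ 0) := by
    refine Φ.contDiffAt_symm (f₀' := De) (Φ.map_source h0) ?_ ?_
    · rw [Φ.left_inv h0, hΦ]; exact hPD
    · rw [Φ.left_inv h0, hΦ]; exact hP.contDiffAt
  -- The inverse function theorem gives analyticity of the inverse only at the image of `0`; the
  -- target is shrunk to an open set where it holds throughout.
  obtain ⟨U, hU, hUo, h0U⟩ := eventually_nhds_iff.1 (hsymm.eventually (by simp))
  let Ψ := (Φ.symm.restrOpen U hUo).symm
  have hΨ : (Ψ : V × N → E) = P := by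
    simp only [Ψ]
    exact hΦ
  refine ⟨Ψ, ?_, fun v => by simp [hΨ, P], ?_, ?_⟩
  · have : Φ 0 ∈ (Φ.symm.restrOpen U hUo).source := by
      rw [OpenPartialHomeomorph.restrOpen_source]
      exact ⟨Φ.map_source h0, h0U⟩
    have h2 : Φ.symm (Φ 0) ∈ (Φ.symm.restrOpen U hUo).target :=
      (Φ.symm.restrOpen U hUo).map_source this
    rw [Φ.left_inv h0] at h2
    exact h2
  · rw [hΨ]; exact hP.contDiffOn
  · intro y hy
    have hy' : y ∈ (Φ.symm.restrOpen U hUo).source := hy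
    rw [OpenPartialHomeomorph.restrOpen_source] at hy'
    exact (hU y hy'.2).contDiffWithinAt

/-- The chart inverse to a local parametrization, together with the slice chart inducing it. -/
theorem IsParamAt.exists_chart {f : X → E} (hf : IsEmbedding f) {q : V → X} {x : X}
    (hq : IsParamAt f q x) (hdim : finrank ℝ V + finrank ℝ N = finrank ℝ E) :
    ∃ (c : OpenPartialHomeomorph X V) (Ψ : OpenPartialHomeomorph (V × N) E),
      x ∈ c.source ∧ c x = 0 ∧ ⇑c.symm = q ∧ MapsTo f c.source Ψ.target ∧
      (∀ z ∈ c.source, Ψ.symm (f z) = (c z, 0)) ∧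
      ContDiffOn ℝ ω Ψ Ψ.source ∧ ContDiffOn ℝ ω Ψ.symm Ψ.target := by
  obtain ⟨Ψ, h0, hΨ, hs, hs'⟩ := exists_slice (N := N) hq.contDiff hq.injective hdim
  have hqc : Continuous q := hf.continuous_iff.2 hq.contDiff.continuous
  let B : Set V := {v | (v, (0 : N)) ∈ Ψ.source}
  have hB : IsOpen B := Ψ.open_source.preimage (by fun_prop)
  -- Openness of `q` at `0` is what excludes other sheets of `X`: near `x` every point is some `q v`
  -- with `v ∈ B`, and the slice chart recovers `v`.
  have hqB : q '' B ∈ 𝓝 x := by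
    rw [← hq.map_nhds]
    exact image_mem_map (hB.mem_nhds h0)
  obtain ⟨O, hOB, hO, hxO⟩ := mem_nhds_iff.1 hqB
  have key : ∀ v ∈ B, Ψ.symm (f (q v)) = (v, 0) := fun v hv => by
    have : f (q v) = Ψ (v, 0) := (hΨ v).symm
    rw [this, Ψ.left_inv hv]
  have htgt : ∀ v ∈ B, f (q v) ∈ Ψ.target := fun v hv => by
    have : f (q v) = Ψ (v, 0) := (hΨ v).symm
    rw [this]
    exact Ψ.map_source hv
  have hm : MapsTo f O Ψ.target := by
    intro z hz
    obtain ⟨v, hv, rfl⟩ := hOB hz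
    exact htgt v hv
  let c : OpenPartialHomeomorph X V :=
    { toFun := fun z => (Ψ.symm (f z)).1
      invFun := q
      source := O
      target := B ∩ q ⁻¹' O
      map_source' := by
        intro z hz
        obtain ⟨v, hv, rfl⟩ := hOB hz
        rw [key v hv]
        exact ⟨hv, hz⟩
      map_target' := fun v hv => hv.2
      left_inv' := by
        intro z hz
        obtain ⟨v, hv, rfl⟩ := hOB hz
        rw [key v hv]
      right_inv' := fun v hv => by rw [key v hv.1]
      open_source := hO
      open_target := hB.inter (hO.preimage hqc)
      continuousOn_toFun := continuous_fst.comp_continuousOn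
        (Ψ.continuousOn_symm.comp hf.continuous.continuousOn hm)
      continuousOn_invFun := hqc.continuousOn }
  have hcz : ∀ z ∈ O, Ψ.symm (f z) = (c z, 0) := by
    intro z hz
    obtain ⟨v, hv, rfl⟩ := hOB hz
    change _ = ((Ψ.symm (f (q v))).1, (0 : N))
    rw [key v hv]
  refine ⟨c, Ψ, hxO, ?_, rfl, hm, hcz, hs, hs'⟩
  change (Ψ.symm (f x)).1 = 0
  rw [← hq.apply_zero, key 0 h0]

/-- The first coordinate of the slice chart inverts `q` and is defined on the ambient space, so
derivatives can be taken there without any chart of `X`. -/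
theorem IsParamAt.exists_leftInverse {f : X → E} (hf : IsEmbedding f) {q : V → X} {x : X}
    (hq : IsParamAt f q x) :
    ∃ r : E → V, ContDiffAt ℝ ω r (f x) ∧ r (f x) = 0 ∧ (∀ᶠ v in 𝓝 0, r (f (q v)) = v) ∧
      ∀ᶠ z in 𝓝 x, q (r (f z)) = z := by
  have hle : finrank ℝ V ≤ finrank ℝ E := LinearMap.finrank_le_finrank_of_injective
    (f := (fderiv ℝ (f ∘ q) 0).toLinearMap) hq.injective
  obtain ⟨c, Ψ, hx, hcx, hcq, hm, hcz, -, hs⟩ := hq.exists_chart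
    (N := EuclideanSpace ℝ (Fin (finrank ℝ E - finrank ℝ V))) hf (by simp; omega)
  have hr : ∀ z ∈ c.source, (Ψ.symm (f z)).1 = c z := fun z hz => by rw [hcz z hz]
  refine ⟨fun y => (Ψ.symm y).1, ?_, ?_, ?_, ?_⟩
  · exact contDiffAt_fst.comp _ (hs.contDiffAt (Ψ.open_target.mem_nhds (hm hx)))
  · exact (hr x hx).trans hcx
  · have h0 : c.target ∈ 𝓝 (0 : V) := c.open_target.mem_nhds (hcx ▸ c.map_source hx)
    filter_upwards [h0] with v hv
    rw [← hcq, hr _ (c.map_target hv), c.right_inv hv]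
  · filter_upwards [c.open_source.mem_nhds hx] with z hz
    rw [hr z hz, ← hcq, c.left_inv hz]

end Param

/-- In a group of matrices, complementary subspaces of the domain of a local parametrization at `1`
provide coordinates of the second kind. -/
theorem IsParamAt.map_mul_nhds {V A G : Type*} [NormedAddCommGroup V] [NormedSpace ℝ V]
    [FiniteDimensional ℝ V] [NormedRing A] [NormedAlgebra ℝ A] [FiniteDimensional ℝ A]
    [Group G] [TopologicalSpace G] {f : G → A} (hf : IsEmbedding f)
    (hf1 : f 1 = 1) (hmul : ∀ g h, f (g * h) = f g * f h) {q : V → G} (hq : IsParamAt f q 1)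
    {m h : Submodule ℝ V} (hmh : IsCompl m h) :
    map (fun z : m × h => q z.1 * q z.2) (𝓝 0) = 𝓝 1 := by
  obtain ⟨r, hr, hr0, hrq, hqr⟩ := hq.exists_leftInverse hf
  rw [hf1] at hr hr0
  have hr1 : DifferentiableAt ℝ r 1 := hr.differentiableAt (by simp)
  have hone : (f ∘ q) 0 = 1 := by rw [Function.comp_apply, hq.apply_zero, hf1]
  let D := fderiv ℝ (f ∘ q) 0
  have hD : HasFDerivAt (f ∘ q) D 0 :=
    (hq.contDiff.contDiffAt.differentiableAt (by simp)).hasFDerivAt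
  have hrD : ∀ v, fderiv ℝ r 1 (D v) = v := by
    have h1 : HasFDerivAt r (fderiv ℝ r 1) ((f ∘ q) 0) := by
      rw [hone]
      exact hr1.hasFDerivAt
    have h3 := (h1.comp (0 : V) hD).unique ((hasFDerivAt_id (0 : V)).congr_of_eventuallyEq hrq)
    exact fun v => DFunLike.congr_fun h3 v
  let P : m × h → A := fun z => (f ∘ q) z.1 * (f ∘ q) z.2
  have hP0 : P 0 = 1 := by
    simp only [P, Prod.fst_zero, Prod.snd_zero, Submodule.coe_zero, hone, mul_one]
  have hPc : ContDiff ℝ ω P :=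
    (hq.contDiff.comp (m.subtypeL.contDiff.comp contDiff_fst)).mul
      (hq.contDiff.comp (h.subtypeL.contDiff.comp contDiff_snd))
  have hP : ∀ z : m × h, fderiv ℝ P 0 z = D z.1 + D z.2 := by
    have hl : HasFDerivAt (fun z : m × h => (f ∘ q) z.1)
        (D.comp (m.subtypeL.comp (ContinuousLinearMap.fst ℝ m h))) 0 :=
      HasFDerivAt.comp (0 : m × h) (g := f ∘ q)
        (by simpa using hD) (m.subtypeL.comp (ContinuousLinearMap.fst ℝ m h)).hasFDerivAt
    have hr' : HasFDerivAt (fun z : m × h => (f ∘ q) z.2)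
        (D.comp (h.subtypeL.comp (ContinuousLinearMap.snd ℝ m h))) 0 :=
      HasFDerivAt.comp (0 : m × h) (g := f ∘ q)
        (by simpa using hD) (h.subtypeL.comp (ContinuousLinearMap.snd ℝ m h)).hasFDerivAt
    intro z
    rw [show fderiv ℝ P 0 = _ from (hl.mul' hr').fderiv]
    simp only [Prod.fst_zero, Prod.snd_zero, Submodule.coe_zero, hone]
    simp [add_comm]
  let μ : m × h → V := r ∘ P
  have hcd : ContDiffAt ℝ ω μ 0 := by
    refine ContDiffAt.comp (0 : m × h) ?_ hPc.contDiffAt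
    rw [hP0]
    exact hr
  have hμ0 : μ 0 = 0 := (congrArg r hP0).trans hr0
  have hμ' : ∀ z : m × h, fderiv ℝ μ 0 z = (z.1 : V) + (z.2 : V) := by
    intro z
    rw [fderiv_comp (0 : m × h) (by rw [hP0]; exact hr1)
      (hPc.contDiffAt.differentiableAt (by simp)), hP0, ContinuousLinearMap.comp_apply, hP,
      ← map_add, hrD]
  have hmap : map μ (𝓝 0) = 𝓝 0 := by
    conv_rhs => rw [← hμ0]
    refine (hcd.hasStrictFDerivAt (by simp)).map_nhds_eq_of_surj ?_
    refine LinearMap.range_eq_top.2 fun v => ?_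
    obtain ⟨a, ha, b, hb, hab⟩ := Submodule.mem_sup.1
      (show v ∈ m ⊔ h by rw [hmh.sup_eq_top]; trivial)
    exact ⟨(⟨a, ha⟩, ⟨b, hb⟩), (hμ' _).trans hab⟩
  have hfP : ∀ z : m × h, f (q z.1 * q z.2) = P z := fun z => hmul _ _
  have hcont : Tendsto (fun z : m × h => q z.1 * q z.2) (𝓝 0) (𝓝 1) := by
    rw [hf.tendsto_nhds_iff, hf1, ← hP0]
    exact (hPc.continuous.tendsto 0).congr fun z => (hfP z).symm
  have hev : (fun z : m × h => q z.1 * q z.2) =ᶠ[𝓝 0] q ∘ μ := by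
    filter_upwards [hcont.eventually hqr] with z hz
    rw [hfP] at hz
    exact hz.symm
  rw [Filter.map_congr hev, ← Filter.map_map, hmap, hq.map_nhds]

/-- A smooth map which is open on complements of the kernel of its derivative restricts to a local
parametrization. -/
theorem exists_isParamAt_of_isCompl {V E X : Type*} [NormedAddCommGroup V] [NormedSpace ℝ V]
    [FiniteDimensional ℝ V] [NormedAddCommGroup E] [NormedSpace ℝ E] [TopologicalSpace X]
    {f : X → E} {p : V → X} {x : X} (hp0 : p 0 = x) (hp : ContDiff ℝ ω (f ∘ p))
    (hmap : ∀ m h : Submodule ℝ V, IsCompl m h → (∀ v ∈ h, fderiv ℝ (f ∘ p) 0 v = 0) →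
      map (fun z : m × h => p z.1) (𝓝 0) = 𝓝 x) :
    ∃ n ≤ finrank ℝ V, ∃ q : EuclideanSpace ℝ (Fin n) → X, IsParamAt f q x := by
  obtain ⟨m, hm⟩ := Submodule.exists_isCompl (LinearMap.ker (fderiv ℝ (f ∘ p) 0).toLinearMap)
  have hq : IsParamAt f (fun v : m => p v) x := by
    refine ⟨?_, hp0, hp.comp m.subtypeL.contDiff, ?_⟩
    -- The map does not depend on the kernel component, so that factor can be projected away.
    · have h := hmap m _ hm.symm fun v hv => hv
      rw [show (fun z : m × LinearMap.ker (fderiv ℝ (f ∘ p) 0).toLinearMap => p z.1) =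
        (fun v : m => p v) ∘ Prod.fst from rfl, ← Filter.map_map] at h
      rwa [← show map Prod.fst (𝓝 (0 : m × LinearMap.ker (fderiv ℝ (f ∘ p) 0).toLinearMap)) = 𝓝 0
        from map_fst_nhds _]
    · have h1 : HasFDerivAt (f ∘ p) (fderiv ℝ (f ∘ p) 0) (m.subtypeL 0) := by
        rw [map_zero]
        exact (hp.contDiffAt.differentiableAt (by simp)).hasFDerivAt
      have h2 : HasFDerivAt (f ∘ fun v : m => p v) _ 0 := h1.comp (0 : m) m.subtypeL.hasFDerivAt
      rw [h2.fderiv, injective_iff_map_eq_zero]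
      intro v hv
      exact Subtype.ext ((Submodule.disjoint_def.1 hm.disjoint) _ hv v.2)
  exact ⟨finrank ℝ m, Submodule.finrank_le m, _,
    hq.comp_equiv (ContinuousLinearEquiv.ofFinrankEq finrank_euclideanSpace_fin)⟩

/-! ### Smooth structures given by local parametrizations -/

section Structure

variable {n : ℕ} {X : Type} [TopologicalSpace X]

/-- The preferred charts of `s` are inverse to the local parametrizations `q`. -/
def SmoothStructure.IsParametrized (s : SmoothStructure n X)
    (q : X → EuclideanSpace ℝ (Fin n) → X) : Prop :=
  ∀ x, s.charted.chartAt x x = 0 ∧ ⇑(s.charted.chartAt x).symm = q x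

/-- Transition maps are composites of ambient slice charts restricted to the slice, hence analytic.
The same slice charts, followed by a linear identification of the product with `E`, are codomain
charts in which `f` is `v ↦ (v, 0)`. -/
theorem exists_smoothStructure {E : Type} [NormedAddCommGroup E] [NormedSpace ℝ E]
    [FiniteDimensional ℝ E] {f : X → E} (hf : IsEmbedding f)
    {q : X → EuclideanSpace ℝ (Fin n) → X} (hq : ∀ x, IsParamAt f (q x) x) :
    ∃ s : SmoothStructure n X, s.IsEmbedded f ∧ s.IsParametrized q := by
  -- Stated pointwise: `n ≤ finrank ℝ E`, which makes the truncated subtraction exact, follows from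
  -- a parametrization and so needs a point of `X`.
  have hdim : ∀ x : X, finrank ℝ (EuclideanSpace ℝ (Fin n)) +
      finrank ℝ (EuclideanSpace ℝ (Fin (finrank ℝ E - n))) = finrank ℝ E := fun x => by
    have := LinearMap.finrank_le_finrank_of_injective
      (f := (fderiv ℝ (f ∘ q x) 0).toLinearMap) (hq x).injective
    simp only [finrank_euclideanSpace_fin] at this ⊢
    omega
  choose c Ψ hc hc0 hcq hm hcz hs hs' using fun x => (hq x).exists_chart hf (hdim x)
  let C : ChartedSpace (EuclideanSpace ℝ (Fin n)) X :=
    { atlas := range c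
      chartAt := c
      mem_chart_source := hc
      chart_mem_atlas := fun x => mem_range_self x }
  have hfΨ : ∀ x, ∀ v ∈ (c x).target, (v, 0) ∈ (Ψ x).source ∧ Ψ x (v, 0) = f ((c x).symm v) := by
    intro x v hv
    have hv' := (c x).map_target hv
    have h1 := hcz x _ hv'
    rw [(c x).right_inv hv] at h1
    have h2 := hm x hv'
    exact ⟨h1 ▸ (Ψ x).map_target h2, by rw [← h1, (Ψ x).right_inv h2]⟩
  have hM : IsManifold (𝓡 n) ∞ X := by
    apply isManifold_of_contDiffOn
    rintro _ _ ⟨x, rfl⟩ ⟨y, rfl⟩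
    have hsub : ((c x).symm ≫ₕ c y).source ⊆ (fun v => Ψ x (v, 0)) ⁻¹' (Ψ y).target ∩
        (fun v => (v, (0 : EuclideanSpace ℝ (Fin (finrank ℝ E - n))))) ⁻¹' (Ψ x).source := by
      intro v hv
      rw [OpenPartialHomeomorph.trans_source] at hv
      have := hfΨ x v hv.1
      refine ⟨?_, this.1⟩
      rw [mem_preimage, this.2]
      exact hm y hv.2
    have hcd : ContDiffOn ℝ ω (fun v => ((Ψ y).symm (Ψ x (v, 0))).1)
        ((c x).symm ≫ₕ c y).source := by
      refine contDiff_fst.comp_contDiffOn ((hs' y).comp ((hs x).comp ?_ fun v hv => (hsub hv).2)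
        fun v hv => (hsub hv).1)
      fun_prop
    simp only [modelWithCornersSelf_coe, modelWithCornersSelf_coe_symm, range_id, inter_univ,
      preimage_id_eq, id_eq, Function.comp_def]
    refine (hcd.of_le (by simp)).congr fun v hv => ?_
    rw [OpenPartialHomeomorph.trans_source] at hv
    rw [(hfΨ x v hv.1).2, hcz y _ hv.2]
    rfl
  refine ⟨⟨C, hM⟩, ⟨?_, hf⟩, fun x => ⟨hc0 x, hcq x⟩⟩
  refine Manifold.IsImmersionOfComplement.isImmersion
    (F := EuclideanSpace ℝ (Fin (finrank ℝ E - n))) fun x => ?_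
  let e : (EuclideanSpace ℝ (Fin n) × EuclideanSpace ℝ (Fin (finrank ℝ E - n))) ≃L[ℝ] E :=
    ContinuousLinearEquiv.ofFinrankEq (by rw [finrank_prod]; exact hdim x)
  let ψ : OpenPartialHomeomorph E E :=
    (Ψ x).symm.trans e.toHomeomorph.toOpenPartialHomeomorph
  have hψs : ψ.source = (Ψ x).target := by simp [ψ]
  refine Manifold.IsImmersionAtOfComplement.mk_of_charts e (c x) ψ (hc x) ?_
    (IsManifold.subset_maximalAtlas (mem_range_self x)) ?_ ?_ ?_
  · rw [hψs]
    exact hm x (hc x)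
  · rw [IsManifold.mem_maximalAtlas_iff]
    refine StructureGroupoid.mem_maximalAtlas_of_mem_groupoid _ ?_
    rw [contDiffGroupoid, mem_groupoid_of_pregroupoid]
    simp only [contDiffPregroupoid, modelWithCornersSelf_coe,
      modelWithCornersSelf_coe_symm,
      range_id, inter_univ, preimage_id_eq, id_eq, Function.comp_id, Function.id_comp]
    constructor
    · rw [hψs]
      exact (e.contDiff.comp_contDiffOn (hs' x)).of_le (by simp)
    · have ht : ψ.target = e.symm ⁻¹' (Ψ x).source := by simp [ψ]
      rw [ht]
      exact ((hs x).comp e.symm.contDiff.contDiffOn fun v hv => hv).of_le (by simp)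
  · rw [hψs]
    exact hm x
  · intro v hv
    simp only [mfld_simps] at hv ⊢
    have := hfΨ x v hv
    change e ((Ψ x).symm (f ((c x).symm v))) = e (v, 0)
    rw [← this.2, (Ψ x).left_inv this.1]

/-- In the centered charts `h` is the identity, so near `x` it equals the chart at `x` followed by
the inverse chart at `h x`. -/
theorem SmoothStructure.IsParametrized.isLocalDiffeo {Y : Type} [TopologicalSpace Y]
    {s : SmoothStructure n X} {t : SmoothStructure n Y} {q : X → EuclideanSpace ℝ (Fin n) → X}
    {q' : Y → EuclideanSpace ℝ (Fin n) → Y} (hs : s.IsParametrized q) (ht : t.IsParametrized q')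
    {h : X → Y} (hh : ∀ x v, h (q x v) = q' (h x) v) : s.IsLocalDiffeo t h := by
  let := s.charted
  let := t.charted
  have := s.isManifold
  have := t.isManifold
  intro x
  let c := chartAt (EuclideanSpace ℝ (Fin n)) x
  let c' := chartAt (EuclideanSpace ℝ (Fin n)) (h x)
  let e := c.trans c'.symm
  have hc : ContMDiffOn (𝓡 n) (𝓡 n) ∞ c c.source :=
    contMDiffOn_of_mem_maximalAtlas (IsManifold.chart_mem_maximalAtlas x)
  have hc' : ContMDiffOn (𝓡 n) (𝓡 n) ∞ c' c'.source :=
    contMDiffOn_of_mem_maximalAtlas (IsManifold.chart_mem_maximalAtlas (h x))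
  have hcs : ContMDiffOn (𝓡 n) (𝓡 n) ∞ c.symm c.target :=
    contMDiffOn_symm_of_mem_maximalAtlas (IsManifold.chart_mem_maximalAtlas x)
  have hcs' : ContMDiffOn (𝓡 n) (𝓡 n) ∞ c'.symm c'.target :=
    contMDiffOn_symm_of_mem_maximalAtlas (IsManifold.chart_mem_maximalAtlas (h x))
  have hx0 : c x = 0 := (hs x).1
  have hy0 : c' (h x) = 0 := (ht (h x)).1
  refine ⟨⟨e.toPartialEquiv, e.open_source, e.open_target, ?_, ?_⟩, ?_, ?_⟩
  · exact hcs'.comp (hc.mono fun z hz => hz.1) fun z hz => hz.2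
  · exact hcs.comp (hc'.mono fun z hz => hz.1) fun z hz => hz.2
  · refine ⟨mem_chart_source _ x, ?_⟩
    change c x ∈ c'.target
    rw [hx0, ← hy0]
    exact c'.map_source (mem_chart_source _ _)
  · intro z hz
    have hzc : z ∈ c.source := hz.1
    change h z = c'.symm (c z)
    have h1 : c.symm (c z) = z := c.left_inv hzc
    rw [show ⇑c'.symm = q' (h x) from (ht (h x)).2, ← hh, ← show ⇑c.symm = q x from (hs x).2, h1]

/-- A map which is smooth in the coordinates around `x` is smooth at `x`. -/
theorem contMDiffAt_of_eventually {E E' H H' M M' : Type*} [NormedAddCommGroup E] [NormedSpace ℝ E]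
    [NormedAddCommGroup E'] [NormedSpace ℝ E'] [TopologicalSpace H] [TopologicalSpace H']
    [TopologicalSpace M] [TopologicalSpace M'] [ChartedSpace H M] [ChartedSpace H' M']
    {I : ModelWithCorners ℝ E H} {I' : ModelWithCorners ℝ E' H'} {f : M → M'} {x : M}
    {L : E → E'} {m : ℕ∞ω} [I.Boundaryless] [I'.Boundaryless] (hL : ContDiff ℝ m L)
    (hx : L (extChartAt I x x) = extChartAt I' (f x) (f x))
    (h : ∀ᶠ v in 𝓝 (extChartAt I x x),
      f ((extChartAt I x).symm v) = (extChartAt I' (f x)).symm (L v)) :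
    ContMDiffAt I I' m f x := by
  rw [contMDiffAt_iff]
  constructor
  · have h1 : f =ᶠ[𝓝 x] fun z => (extChartAt I' (f x)).symm (L (extChartAt I x z)) := by
      filter_upwards [(continuousAt_extChartAt (I := I) x).eventually h,
        extChartAt_source_mem_nhds (I := I) x] with z hz hz'
      rw [← hz, (extChartAt I x).left_inv hz']
    refine ContinuousAt.congr ?_ h1.symm
    refine ContinuousAt.comp (g := (extChartAt I' (f x)).symm) ?_
      (hL.continuous.continuousAt.comp (continuousAt_extChartAt (I := I) x))
    simp only [hx]
    exact continuousAt_extChartAt_symm (I := I') (f x)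
  · refine ContDiffAt.contDiffWithinAt (hL.contDiffAt.congr_of_eventuallyEq ?_)
    have h2 : ∀ᶠ v in 𝓝 (extChartAt I x x), L v ∈ (extChartAt I' (f x)).target :=
      hL.continuous.continuousAt.eventually
        (by rw [hx]; exact extChartAt_target_mem_nhds (I := I') (f x))
    filter_upwards [h, h2] with v hv hv2
    simp only [Function.comp_apply, hv]
    exact (extChartAt I' (f x)).right_inv hv2

instance {ι : Type*} [Fintype ι] {E H : ι → Type*} [∀ i, NormedAddCommGroup (E i)]
    [∀ i, NormedSpace ℝ (E i)] [∀ i, TopologicalSpace (H i)]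
    (I : ∀ i, ModelWithCorners ℝ (E i) (H i)) [h : ∀ i, (I i).Boundaryless] :
    (ModelWithCorners.pi I).Boundaryless where
  range_eq_univ := by
    refine range_eq_univ.2 fun v => ?_
    choose w hw using fun i => range_eq_univ.1 (h i).range_eq_univ (v i)
    exact ⟨w, funext hw⟩

/-- A bijection which is linear in the coordinates given by local parametrizations is a
diffeomorphism. -/
theorem SmoothStructure.IsParametrized.diffeomorphicToProd {s : SmoothStructure n X}
    {q : X → EuclideanSpace ℝ (Fin n) → X} (hs : s.IsParametrized q)
    {k : ℕ} {m : Fin k → ℕ} {Y : Fin k → Type} [∀ i, TopologicalSpace (Y i)]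
    {t : ∀ i, SmoothStructure (m i) (Y i)} {p : ∀ i, Y i → EuclideanSpace ℝ (Fin (m i)) → Y i}
    (ht : ∀ i, (t i).IsParametrized (p i)) (F : X ≃ ∀ i, Y i)
    (L : EuclideanSpace ℝ (Fin n) ≃L[ℝ] ∀ i, EuclideanSpace ℝ (Fin (m i)))
    (hF : ∀ x v, F (q x v) = fun i => p i (F x i) (L v i)) : DiffeomorphicToProd s t := by
  let := s.charted
  let := fun i => (t i).charted
  have hX0 : ∀ x : X, extChartAt (𝓡 n) x x = 0 := fun x => (hs x).1
  have hXq : ∀ x : X, ⇑(extChartAt (𝓡 n) x).symm = q x := fun x => (hs x).2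
  have hY0 : ∀ y : ∀ i, Y i, extChartAt (ModelWithCorners.pi fun i => 𝓡 (m i)) y y = 0 :=
    fun y => funext fun i => (ht i (y i)).1
  have hYq : ∀ y : ∀ i, Y i, ⇑(extChartAt (ModelWithCorners.pi fun i => 𝓡 (m i)) y).symm =
      fun v i => p i (y i) (v i) := fun y => by
    funext v i
    exact congrFun (ht i (y i)).2 (v i)
  refine ⟨F, fun x => ?_, fun y => ?_⟩
  · refine contMDiffAt_of_eventually L.contDiff (by rw [hX0, hY0, map_zero])
      (Eventually.of_forall fun v => ?_)
    rw [hXq, hYq, hF]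
  · refine contMDiffAt_of_eventually L.symm.contDiff (by rw [hX0, hY0, map_zero])
      (Eventually.of_forall fun v => ?_)
    rw [hXq, hYq, Equiv.symm_apply_eq, hF]
    simp

/-- An embedded smooth structure has at most the dimension of a local parametrization. -/
theorem SmoothStructure.IsEmbedded.le_finrank {E : Type} [NormedAddCommGroup E] [NormedSpace ℝ E]
    [FiniteDimensional ℝ E] {f : X → E} {s : SmoothStructure n X} (hs : s.IsEmbedded f)
    {V : Type*} [NormedAddCommGroup V] [NormedSpace ℝ V] [FiniteDimensional ℝ V] {q : V → X} {x : X}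
    (hq : IsParamAt f q x) : n ≤ finrank ℝ V := by
  let := s.charted
  have hf : IsEmbedding f := hs.isEmbedding
  obtain ⟨F, _, _, hF⟩ := hs.isImmersion.isImmersionAt x
  let c := hF.domChart
  let ψ := hF.codChart
  have hx : x ∈ c.source := hF.mem_domChart_source
  have hfx : f x ∈ ψ.source := hF.mem_codChart_source
  have hcψ : ∀ u ∈ c.target, ψ (f (c.symm u)) = hF.equiv (u, 0) := fun u hu =>
    hF.writtenInCharts (by simpa using hu)
  have hψ : ContDiffOn ℝ ∞ ψ ψ.source := contMDiffOn_iff_contDiffOn.1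
    (contMDiffOn_of_mem_maximalAtlas hF.codChart_mem_maximalAtlas)
  have hψs : ContDiffOn ℝ ∞ ψ.symm ψ.target := contMDiffOn_iff_contDiffOn.1
    (contMDiffOn_symm_of_mem_maximalAtlas hF.codChart_mem_maximalAtlas)
  obtain ⟨r, hr, hr0, -, hqr⟩ := hq.exists_leftInverse hf
  let u₀ := c x
  have hu₀ : u₀ ∈ c.target := c.map_source hx
  have hcx : c.symm u₀ = x := c.left_inv hx
  have hψx : hF.equiv (u₀, 0) = ψ (f x) := by rw [← hcψ u₀ hu₀, hcx]
  -- `T` passes from the given chart to the parametrization and `R` passes back, both through the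
  -- ambient space. Since `R ∘ T` is the identity near `u₀`, the chain rule makes the derivative of
  -- `T` injective.
  let T : EuclideanSpace ℝ (Fin n) → V := fun u => r (ψ.symm (hF.equiv (u, 0)))
  let R : V → EuclideanSpace ℝ (Fin n) := fun v => (hF.equiv.symm (ψ (f (q v)))).1
  have hT : DifferentiableAt ℝ T u₀ := by
    have h1 : DifferentiableAt ℝ (fun u => hF.equiv (u, 0)) u₀ := by fun_prop
    have h2 : DifferentiableAt ℝ ψ.symm (hF.equiv (u₀, 0)) := by
      rw [hψx]
      exact ((hψs.contDiffAt (ψ.open_target.mem_nhds (ψ.map_source hfx))).differentiableAt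
        (by simp))
    have h3 : DifferentiableAt ℝ r (ψ.symm (hF.equiv (u₀, 0))) := by
      rw [hψx, ψ.left_inv hfx]
      exact hr.differentiableAt (by simp)
    exact h3.comp u₀ (h2.comp u₀ h1)
  have hT0 : T u₀ = 0 := by
    change r (ψ.symm (hF.equiv (u₀, 0))) = 0
    rw [hψx, ψ.left_inv hfx, hr0]
  have hR : DifferentiableAt ℝ R (T u₀) := by
    rw [hT0]
    have h1 : DifferentiableAt ℝ (f ∘ q) 0 := hq.contDiff.contDiffAt.differentiableAt (by simp)
    have h2 : DifferentiableAt ℝ ψ ((f ∘ q) 0) := by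
      rw [Function.comp_apply, hq.apply_zero]
      exact (hψ.contDiffAt (ψ.open_source.mem_nhds hfx)).differentiableAt (by simp)
    have h3 := h2.comp 0 h1
    have h4 : DifferentiableAt ℝ (fun w => (hF.equiv.symm w).1) (ψ ((f ∘ q) 0)) := by fun_prop
    exact h4.comp (f := ψ ∘ f ∘ q) (0 : V) h3
  have hRT : R ∘ T =ᶠ[𝓝 u₀] id := by
    have h1 : Tendsto c.symm (𝓝 u₀) (𝓝 x) := by
      have := c.symm.continuousAt hu₀
      rwa [ContinuousAt, hcx] at this
    filter_upwards [c.open_target.mem_nhds hu₀, h1.eventually hqr] with u hu hu'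
    have h2 : ψ.symm (hF.equiv (u, 0)) = f (c.symm u) := by
      rw [← hcψ u hu, ψ.left_inv (hF.source_subset_preimage_source (c.map_target hu))]
    simp only [Function.comp_apply, T, R, h2, hu', hcψ u hu, ContinuousLinearEquiv.symm_apply_apply,
      id_eq]
  have hd : (fderiv ℝ R (T u₀)).comp (fderiv ℝ T u₀) = ContinuousLinearMap.id ℝ _ := by
    rw [← fderiv_comp u₀ hR hT, hRT.fderiv_eq, fderiv_id]
  have hinj : Function.Injective (fderiv ℝ T u₀) := by
    intro a b hab
    have := congrArg (fderiv ℝ R (T u₀)) hab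
    rwa [← ContinuousLinearMap.comp_apply, ← ContinuousLinearMap.comp_apply, hd] at this
  simpa using LinearMap.finrank_le_finrank_of_injective (f := (fderiv ℝ T u₀).toLinearMap) hinj

end Structure

/-! ### The special unitary group and its Lie algebra -/

/-- `-iA` is Hermitian, hence unitarily diagonalizable, and for diagonal matrices both sides are the
product of the exponentials of the entries. -/
theorem det_exp_of_mem_skewAdjoint {ι : Type*} [Fintype ι] [DecidableEq ι] {A : Matrix ι ι ℂ}
    (hA : A ∈ skewAdjoint (Matrix ι ι ℂ)) : (NormedSpace.exp A).det = Complex.exp A.trace := by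
  have hH : ((-Complex.I) • A).IsHermitian := by
    rw [Matrix.IsHermitian, Matrix.conjTranspose_smul, ← Matrix.star_eq_conjTranspose,
      skewAdjoint.mem_iff.1 hA]
    simp
  let U : Matrix ι ι ℂ := hH.eigenvectorUnitary
  have hUU : U * star U = 1 := Unitary.coe_mul_star_self hH.eigenvectorUnitary
  have hinv : U⁻¹ = star U := Matrix.inv_eq_right_inv hUU
  have hAI : A = Complex.I • ((-Complex.I) • A) := by
    rw [smul_smul]; simp
  have hdiag : A = U * Matrix.diagonal (fun i => Complex.I * hH.eigenvalues i) * U⁻¹ := by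
    conv_lhs => rw [hAI, hH.spectral_theorem, Unitary.conjStarAlgAut_apply]
    rw [hinv, ← Matrix.smul_mul, ← Matrix.mul_smul, ← Matrix.diagonal_smul]
    rfl
  have hU : IsUnit U := IsUnit.of_mul_eq_one _ hUU
  have hUd : IsUnit U.det := (Matrix.isUnit_iff_isUnit_det U).1 hU
  rw [hdiag, Matrix.exp_conj _ _ hU, Matrix.det_conj hU, Matrix.exp_diagonal, Matrix.det_diagonal,
    Matrix.trace_mul_comm, ← mul_assoc, Matrix.nonsing_inv_mul _ hUd, one_mul,
    Matrix.trace_diagonal, Complex.exp_sum]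
  simp [Complex.exp_eq_exp_ℂ]

/-- The Lie algebra of `SU(n)`: the skew-adjoint matrices of trace zero. -/
def su (n : ℕ) : Submodule ℝ (Matrix (Fin n) (Fin n) ℂ) :=
  skewAdjoint.submodule ℝ _ ⊓ LinearMap.ker (Matrix.traceLinearMap (Fin n) ℝ ℂ)

theorem mem_su {n : ℕ} {A : Matrix (Fin n) (Fin n) ℂ} :
    A ∈ su n ↔ star A = -A ∧ A.trace = 0 := by
  rw [su, Submodule.mem_inf, LinearMap.mem_ker, Matrix.traceLinearMap_apply]
  rfl

theorem exp_mem_specialUnitaryGroup {n : ℕ} {A : Matrix (Fin n) (Fin n) ℂ} (hA : A ∈ su n) :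
    NormedSpace.exp A ∈ Matrix.specialUnitaryGroup (Fin n) ℂ := by
  rw [mem_su] at hA
  have hs : A ∈ skewAdjoint (Matrix (Fin n) (Fin n) ℂ) := skewAdjoint.mem_iff.2 hA.1
  rw [Matrix.mem_specialUnitaryGroup_iff]
  refine ⟨?_, by rw [det_exp_of_mem_skewAdjoint hs, hA.2, Complex.exp_zero]⟩
  rw [Matrix.mem_unitaryGroup_iff, NormedSpace.star_exp, hA.1,
    ← Matrix.exp_add_of_commute _ _ (Commute.refl A).neg_right, add_neg_cancel, NormedSpace.exp_zero]

/-- The exponential map of `SU(n)`. -/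
def suExp {n : ℕ} (A : su n) : SU n := ⟨NormedSpace.exp (A : Matrix (Fin n) (Fin n) ℂ),
  exp_mem_specialUnitaryGroup A.2⟩

theorem coe_suExp {n : ℕ} (A : su n) :
    (suExp A : Matrix (Fin n) (Fin n) ℂ) = NormedSpace.exp (A : Matrix (Fin n) (Fin n) ℂ) := rfl

theorem suExp_zero {n : ℕ} : suExp (0 : su n) = 1 := Subtype.ext (by simp [coe_suExp])

theorem suExp_add_smul {n : ℕ} (A : su n) (s t : ℝ) :
    suExp ((s + t) • A) = suExp (s • A) * suExp (t • A) := by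
  refine Subtype.ext ?_
  rw [Submonoid.coe_mul, coe_suExp, coe_suExp, coe_suExp,
    ← Matrix.exp_add_of_commute, ← Submodule.coe_add, add_smul]
  exact ((Commute.refl _).smul_left _).smul_right _

theorem contDiff_exp_matrix {ι : Type*} [Fintype ι] [DecidableEq ι] :
    ContDiff ℝ ω (NormedSpace.exp : Matrix ι ι ℂ → Matrix ι ι ℂ) :=
  contDiff_iff_contDiffAt.2 fun A => (NormedSpace.exp_analytic (𝕂 := ℝ) A).contDiffAt

theorem contDiff_coe_suExp {n : ℕ} :
    ContDiff ℝ ω fun A : su n => (suExp A : Matrix (Fin n) (Fin n) ℂ) :=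
  contDiff_exp_matrix.comp (su n).subtypeL.contDiff

theorem continuous_suExp {n : ℕ} : Continuous (suExp (n := n)) :=
  Topology.IsEmbedding.subtypeVal.continuous_iff.2 contDiff_coe_suExp.continuous

theorem hasFDerivAt_coe_suExp {n : ℕ} :
    HasFDerivAt (fun A : su n => (suExp A : Matrix (Fin n) (Fin n) ℂ)) (su n).subtypeL 0 := by
  have h : HasFDerivAt (NormedSpace.exp : Matrix (Fin n) (Fin n) ℂ → _)
      (1 : Matrix (Fin n) (Fin n) ℂ →L[ℝ] _) ((su n).subtypeL 0) := by
    rw [map_zero]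
    exact (hasStrictFDerivAt_exp_zero (𝕂 := ℝ)).hasFDerivAt
  exact h.comp (0 : su n) (su n).subtypeL.hasFDerivAt

/-- The nontrivial inclusion says that the local matrix logarithm maps `SU(n)` near `1` into `su n`.
-/
theorem map_suExp_nhds {n : ℕ} : map suExp (𝓝 (0 : su n)) = 𝓝 1 := by
  apply le_antisymm
  · rw [← suExp_zero]
    exact continuous_suExp.continuousAt
  let M := Matrix (Fin n) (Fin n) ℂ
  have hd : HasStrictFDerivAt (NormedSpace.exp : M → M)
      ((ContinuousLinearEquiv.refl ℝ M : M ≃L[ℝ] M) : M →L[ℝ] M) 0 :=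
    hasStrictFDerivAt_exp_zero (𝕂 := ℝ)
  let e := hd.toOpenPartialHomeomorph NormedSpace.exp
  have he : ⇑e = (NormedSpace.exp : M → M) := hd.toOpenPartialHomeomorph_coe
  have h0 : (0 : M) ∈ e.source := hd.mem_toOpenPartialHomeomorph_source
  have he0 : e 0 = 1 := by rw [he, NormedSpace.exp_zero]
  have hes : e.symm 1 = 0 := by rw [← he0, e.left_inv h0]
  have h1 : (1 : M) ∈ e.target := he0 ▸ e.map_source h0
  have hlog : Tendsto (fun U : SU n => e.symm (U : M)) (𝓝 1) (𝓝 0) := by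
    have hc : ContinuousAt e.symm (((1 : SU n) : M)) := e.symm.continuousAt h1
    have := hc.comp (x := (1 : SU n)) (f := fun U : SU n => (U : M))
      continuous_subtype_val.continuousAt
    simpa only [ContinuousAt, Function.comp_def, OneMemClass.coe_one, hes] using this
  -- Determinant one only gives `exp (trace) = 1`; local injectivity of the complex exponential
  -- excludes nonzero multiples of `2πi`.
  obtain ⟨t, ht, htinj⟩ : ∃ t ∈ 𝓝 (0 : ℂ), InjOn Complex.exp t := by
    have hd : HasStrictDerivAt Complex.exp 1 0 := by
      simpa using Complex.hasStrictDerivAt_exp 0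
    let φ := (hd.hasStrictFDerivAt_equiv one_ne_zero).toOpenPartialHomeomorph Complex.exp
    exact ⟨φ.source, φ.open_source.mem_nhds
      (hd.hasStrictFDerivAt_equiv one_ne_zero).mem_toOpenPartialHomeomorph_source, φ.injOn⟩
  have hmem : ∀ᶠ U : SU n in 𝓝 1, e.symm (U : M) ∈ su n ∧ NormedSpace.exp (e.symm (U : M)) = U := by
    have hsrc := e.open_source.mem_nhds h0
    have hstar : Tendsto (fun A : M => star A) (𝓝 0) (𝓝 0) := by
      have h := (continuous_star (R := M)).tendsto 0
      rwa [show star (0 : M) = 0 from star_zero _] at h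
    have hneg : Tendsto (fun A : M => -A) (𝓝 0) (𝓝 0) := by
      simpa using (continuous_neg (G := M)).tendsto 0
    have htr : Tendsto (fun A : M => A.trace) (𝓝 0) (𝓝 0) := by
      have : Continuous fun A : M => A.trace := continuous_id.matrix_trace
      simpa using this.tendsto 0
    have htgt : ∀ᶠ U : SU n in 𝓝 1, (U : M) ∈ e.target :=
      continuous_subtype_val.continuousAt.eventually (e.open_target.mem_nhds h1)
    filter_upwards [htgt, hlog.eventually (hstar.eventually hsrc),
      hlog.eventually (hneg.eventually hsrc), hlog.eventually (htr.eventually ht)]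
      with U hU hU1 hU2 hU3
    have hexp : NormedSpace.exp (e.symm (U : M)) = U := by
      rw [← he, e.right_inv hU]
    have hUm := Matrix.mem_specialUnitaryGroup_iff.1 U.2
    -- Both sides are small logarithms of `star U = U⁻¹`, and the exponential is injective on
    -- `e.source`.
    have hskew : star (e.symm (U : M)) = -e.symm (U : M) := by
      refine e.injOn hU1 hU2 ?_
      rw [he, ← NormedSpace.star_exp, hexp, Matrix.exp_neg, hexp]
      exact (Matrix.inv_eq_right_inv (Matrix.mem_unitaryGroup_iff.1 hUm.1)).symm
    refine ⟨mem_su.2 ⟨hskew, htinj hU3 (mem_of_mem_nhds ht) ?_⟩, hexp⟩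
    rw [Complex.exp_zero, ← det_exp_of_mem_skewAdjoint (skewAdjoint.mem_iff.2 hskew), hexp]
    exact hUm.2
  intro s hs
  rw [mem_map] at hs
  obtain ⟨O, hO, hOs⟩ := (mem_nhds_induced Subtype.val (0 : su n) _).1 hs
  filter_upwards [hmem, hlog.eventually hO] with U hU hU'
  have h2 : (⟨e.symm (U : M), hU.1⟩ : su n) ∈ suExp ⁻¹' s := hOs hU'
  have h3 : suExp ⟨e.symm (U : M), hU.1⟩ = U := Subtype.ext hU.2
  rwa [mem_preimage, h3] at h2

instance (n : ℕ) : IsTopologicalGroup (SU n) where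
  continuous_inv := Topology.IsEmbedding.subtypeVal.continuous_iff.2
    (continuous_star.comp continuous_subtype_val)

instance (n : ℕ) : CompactSpace (SU n) := by
  have : ProperSpace (Matrix (Fin n) (Fin n) ℂ) := FiniteDimensional.proper ℝ _
  refine isCompact_iff_compactSpace.1 (Metric.isCompact_of_isClosed_isBounded ?_ ?_)
  · have : (Matrix.specialUnitaryGroup (Fin n) ℂ : Set (Matrix (Fin n) (Fin n) ℂ)) =
        {A | A * star A = 1} ∩ {A | A.det = 1} := by
      ext A
      rw [SetLike.mem_coe, Matrix.mem_specialUnitaryGroup_iff, Matrix.mem_unitaryGroup_iff]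
      rfl
    rw [this]
    exact (isClosed_eq (by fun_prop) continuous_const).inter
      (isClosed_eq (continuous_id.matrix_det) continuous_const)
  · refine (Metric.isBounded_closedBall (x := (0 : Matrix (Fin n) (Fin n) ℂ))
      (r := 1 + ‖(1 : Matrix (Fin n) (Fin n) ℂ)‖)).subset ?_
    intro A hA
    rw [mem_closedBall_zero_iff]
    -- This gives `‖A‖ ^ 2 = ‖1‖`; keeping `‖1‖` in the radius also covers `n = 0`, where it is not
    -- `1`.
    have h := CStarRing.norm_star_mul_self (x := A)
    rw [Matrix.mem_unitaryGroup_iff'.1 (Matrix.mem_specialUnitaryGroup_iff.1 hA).1] at h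
    nlinarith [norm_nonneg A]

/-- Multiplication by `i` exchanges self-adjoint and skew-adjoint matrices, so each half has real
dimension `n ^ 2`. The trace of a skew-adjoint matrix is purely imaginary, so its vanishing is one
real condition. -/
theorem finrank_su {n : ℕ} (hn : 1 ≤ n) : finrank ℝ (su n) = n ^ 2 - 1 := by
  let M := Matrix (Fin n) (Fin n) ℂ
  have hM : finrank ℝ M = 2 * n ^ 2 := by
    rw [finrank_real_of_complex, finrank_matrix]
    simp; ring
  have e1 := (StarModule.decomposeProdAdjoint ℝ M).finrank_eq
  have e2 : finrank ℝ (skewAdjoint M) = finrank ℝ (selfAdjoint M) := by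
    refine (LinearEquiv.ofBijective (skewAdjoint.negISMul (A := M)) ⟨?_, ?_⟩).finrank_eq
    · intro a b hab
      rw [Subtype.ext_iff, ← skewAdjoint.I_smul_neg_I a, hab, skewAdjoint.I_smul_neg_I]
    · intro a
      refine ⟨⟨Complex.I • (a : M), ?_⟩, ?_⟩
      · rw [skewAdjoint.mem_iff, star_smul, selfAdjoint.mem_iff.1 a.2]
        simp
      · ext1
        simp [smul_smul]
  have : Module.Finite ℝ (selfAdjoint M) :=
    inferInstanceAs (Module.Finite ℝ (selfAdjoint.submodule ℝ M))
  have : Module.Finite ℝ (skewAdjoint M) :=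
    inferInstanceAs (Module.Finite ℝ (skewAdjoint.submodule ℝ M))
  rw [finrank_prod] at e1
  let φ : skewAdjoint.submodule ℝ M →ₗ[ℝ] ℝ :=
    Complex.imLm ∘ₗ Matrix.traceLinearMap (Fin n) ℝ ℂ ∘ₗ (skewAdjoint.submodule ℝ M).subtype
  have hφ : Function.Surjective φ := by
    intro c
    have hn' : (n : ℂ) ≠ 0 := by exact_mod_cast (by omega : n ≠ 0)
    refine ⟨⟨(Complex.I * (c / n : ℝ)) • 1, ?_⟩, ?_⟩
    · change (Complex.I * (c / n : ℝ)) • (1 : M) ∈ skewAdjoint M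
      rw [skewAdjoint.mem_iff, star_smul, star_one, ← neg_smul]
      simp
    · change (((Complex.I * (c / n : ℝ)) • (1 : M)).trace).im = c
      rw [Matrix.trace_smul, Matrix.trace_one, Fintype.card_fin]
      push_cast
      rw [smul_eq_mul, mul_assoc, div_mul_cancel₀ _ hn']
      simp
  have hmap : (LinearMap.ker φ).map (skewAdjoint.submodule ℝ M).subtype = su n := by
    ext A
    rw [Submodule.mem_map, mem_su]
    constructor
    · rintro ⟨⟨B, hB⟩, h, rfl⟩
      have hB' : star B = -B := hB
      have him : B.trace.im = 0 := h
      refine ⟨hB', Complex.ext ?_ him⟩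
      have : (star B.trace).re = (-B.trace).re := by
        rw [← Matrix.trace_neg, ← hB', ← Matrix.trace_conjTranspose]
        rfl
      rw [Complex.star_def, Complex.conj_re, Complex.neg_re] at this
      change B.trace.re = 0
      linarith
    · rintro ⟨h1, h2⟩
      refine ⟨⟨A, h1⟩, ?_, rfl⟩
      change A.trace.im = 0
      rw [h2, Complex.zero_im]
  have h3 := φ.finrank_range_add_finrank_ker
  rw [LinearMap.range_eq_top.2 hφ, finrank_top, finrank_self] at h3
  have h4 : finrank ℝ (skewAdjoint.submodule ℝ M) = finrank ℝ (skewAdjoint M) := rfl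
  have h5 : finrank ℝ (su n) = finrank ℝ (LinearMap.ker φ) := by
    rw [← hmap]
    exact Submodule.finrank_map_subtype_eq _ _
  omega

/-! ### Schur's lemma for the unitary groups -/

/-- Unitaries span a C⋆-algebra linearly, so `A` commutes with all matrices, in particular with the
matrix units. -/
theorem exists_eq_smul_one_of_commute_unitary {n : ℕ} {A : Matrix (Fin n) (Fin n) ℂ}
    (h : ∀ U ∈ Matrix.unitaryGroup (Fin n) ℂ, U * A = A * U) :
    ∃ c : ℂ, A = c • (1 : Matrix (Fin n) (Fin n) ℂ) := by
  have hall : ∀ B : Matrix (Fin n) (Fin n) ℂ, B * A = A * B := by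
    intro B
    have hB : B ∈ Submodule.span ℂ (unitary (Matrix (Fin n) (Fin n) ℂ) : Set _) := by
      rw [CStarAlgebra.span_unitary]; trivial
    induction hB using Submodule.span_induction with
    | mem U hU => exact h U hU
    | zero => simp
    | add x y _ _ hx hy => rw [add_mul, mul_add, hx, hy]
    | smul c x _ hx => rw [smul_mul_assoc, mul_smul_comm, hx]
  obtain ⟨c, hc⟩ := Matrix.mem_range_scalar_of_commute_single (M := A) fun i j _ => hall _
  refine ⟨c, ?_⟩
  rw [← hc, Matrix.scalar_apply, Matrix.smul_one_eq_diagonal]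

theorem smul_mem_unitaryGroup {ι : Type*} [Fintype ι] [DecidableEq ι] {c : ℂ} (hc : ‖c‖ = 1)
    {A : Matrix ι ι ℂ} (hA : A ∈ Matrix.unitaryGroup ι ℂ) : c • A ∈ Matrix.unitaryGroup ι ℂ := by
  rw [Matrix.mem_unitaryGroup_iff] at hA ⊢
  rw [star_smul, smul_mul_smul_comm, hA, Complex.star_def, Complex.mul_conj,
    Complex.normSq_eq_norm_sq, hc]
  simp

/-- The phase is an `n`-th root of the determinant. It disappears under conjugation, which lets
`SU(n)` replace `U(n)`. -/
theorem exists_phase {n : ℕ} (hn : 1 ≤ n) {V : Matrix (Fin n) (Fin n) ℂ}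
    (hV : V ∈ Matrix.unitaryGroup (Fin n) ℂ) :
    ∃ (c : ℂ) (S : SU n), ‖c‖ = 1 ∧ V = c • (S : Matrix (Fin n) (Fin n) ℂ) := by
  have hn0 : n ≠ 0 := by omega
  obtain ⟨c, hc⟩ := IsAlgClosed.exists_pow_nat_eq V.det hn
  have hdet : ‖V.det‖ = 1 := CStarRing.norm_of_mem_unitary (Matrix.det_of_mem_unitary hV)
  have hcn : ‖c‖ = 1 := by
    rw [← hc, norm_pow] at hdet
    exact (pow_eq_one_iff_of_nonneg (norm_nonneg c) hn0).1 hdet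
  have hc0 : c ≠ 0 := norm_ne_zero_iff.1 (by rw [hcn]; exact one_ne_zero)
  have hci : ‖c⁻¹‖ = 1 := by rw [norm_inv, hcn, inv_one]
  refine ⟨c, ⟨c⁻¹ • V, Matrix.mem_specialUnitaryGroup_iff.2
    ⟨smul_mem_unitaryGroup hci hV, ?_⟩⟩, hcn, ?_⟩
  · rw [Matrix.det_smul, Fintype.card_fin, ← hc, ← mul_pow, inv_mul_cancel₀ hc0, one_pow]
  · rw [smul_smul, mul_inv_cancel₀ hc0, one_smul]

theorem exists_eq_smul_one_of_commute_SU {n : ℕ} (hn : 1 ≤ n) {A : Matrix (Fin n) (Fin n) ℂ}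
    (h : ∀ U : SU n, (U : Matrix (Fin n) (Fin n) ℂ) * A = A * U) :
    ∃ c : ℂ, A = c • (1 : Matrix (Fin n) (Fin n) ℂ) := by
  refine exists_eq_smul_one_of_commute_unitary fun V hV => ?_
  obtain ⟨c, S, -, rfl⟩ := exists_phase hn hV
  rw [smul_mul_assoc, mul_smul_comm, h S]

theorem mem_center_SU_iff {n : ℕ} (hn : 1 ≤ n) {U : SU n} :
    U ∈ Subgroup.center (SU n) ↔
      ∃ c : ℂ, (U : Matrix (Fin n) (Fin n) ℂ) = c • (1 : Matrix (Fin n) (Fin n) ℂ) := by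
  rw [Subgroup.mem_center_iff]
  constructor
  · intro h
    exact exists_eq_smul_one_of_commute_SU hn fun V => congrArg Subtype.val (h V)
  · rintro ⟨c, hc⟩ V
    refine Subtype.ext ?_
    rw [Submonoid.coe_mul, Submonoid.coe_mul, hc]
    simp

/-- The center of `SU(n)` consists of the `n`-th roots of unity. -/
theorem exists_center_SU_equiv {n : ℕ} (hn : 1 ≤ n) :
    Nonempty (rootsOfUnity n ℂ ≃* Subgroup.center (SU n)) := by
  have hn0 : n ≠ 0 := by omega
  have hpow : ∀ z : rootsOfUnity n ℂ, ((z : ℂˣ) : ℂ) ^ n = 1 := fun z => by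
    have := (mem_rootsOfUnity n (z : ℂˣ)).1 z.2
    rw [← Units.val_pow_eq_pow_val, this, Units.val_one]
  have hmem : ∀ z : rootsOfUnity n ℂ, ((z : ℂˣ) : ℂ) • (1 : Matrix (Fin n) (Fin n) ℂ) ∈
      Matrix.specialUnitaryGroup (Fin n) ℂ := fun z => by
    rw [Matrix.mem_specialUnitaryGroup_iff]
    refine ⟨smul_mem_unitaryGroup ?_ (one_mem _), ?_⟩
    · exact Complex.norm_eq_one_of_pow_eq_one (hpow z) hn0
    · rw [Matrix.det_smul, Fintype.card_fin, Matrix.det_one, hpow, mul_one]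
  let φ : rootsOfUnity n ℂ →* Subgroup.center (SU n) :=
    { toFun := fun z => ⟨⟨_, hmem z⟩, (mem_center_SU_iff hn).2 ⟨_, rfl⟩⟩
      map_one' := Subtype.ext (Subtype.ext (by simp))
      map_mul' := fun z w => Subtype.ext (Subtype.ext (by simp [smul_smul, mul_comm])) }
  refine ⟨MulEquiv.ofBijective φ ⟨fun z w h => ?_, fun U => ?_⟩⟩
  · have h1 : ((z : ℂˣ) : ℂ) • (1 : Matrix (Fin n) (Fin n) ℂ) = ((w : ℂˣ) : ℂ) • 1 :=
      congrArg (fun V : Subgroup.center (SU n) => (V.1 : Matrix (Fin n) (Fin n) ℂ)) h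
    have h2 := congrFun (congrFun h1 ⟨0, hn⟩) ⟨0, hn⟩
    simp only [Matrix.smul_apply, Matrix.one_apply_eq, smul_eq_mul, mul_one] at h2
    exact Subtype.ext (Units.ext h2)
  · obtain ⟨c, hc⟩ := (mem_center_SU_iff hn).1 U.2
    have hdet := (Matrix.mem_specialUnitaryGroup_iff.1 U.1.2).2
    rw [hc, Matrix.det_smul, Fintype.card_fin, Matrix.det_one, mul_one] at hdet
    have hc0 : c ≠ 0 := by
      rintro rfl
      rw [zero_pow hn0] at hdet
      exact zero_ne_one hdet
    refine ⟨⟨Units.mk0 c hc0, (mem_rootsOfUnity n _).2 (Units.ext (by simpa using hdet))⟩, ?_⟩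
    exact Subtype.ext (Subtype.ext hc.symm)

theorem isCyclic_center_SU {n : ℕ} (hn : 1 ≤ n) : IsCyclic (Subgroup.center (SU n)) ∧
    Nat.card (Subgroup.center (SU n)) = n := by
  obtain ⟨e⟩ := exists_center_SU_equiv hn
  have : NeZero n := ⟨by omega⟩
  refine ⟨isCyclic_of_surjective e e.surjective, ?_⟩
  rw [← Nat.card_congr e.toEquiv, Complex.card_rootsOfUnity]

/-! ### One-parameter groups -/

/-- If an orbit of a one-parameter group of linear transformations has velocity zero at time `0`,
then it is constant. -/
theorem eq_of_fderiv_eq_zero {V E : Type*} [NormedAddCommGroup V] [NormedSpace ℝ V]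
    [NormedAddCommGroup E] [NormedSpace ℝ E] {p : V → E} (hp : DifferentiableAt ℝ p 0) {v : V}
    (hv : fderiv ℝ p 0 v = 0) {T : ℝ → E →L[ℝ] E}
    (hT : ∀ s t : ℝ, p ((s + t) • v) = T s (p (t • v))) (t : ℝ) : p (t • v) = p 0 := by
  have h0 : HasDerivAt (fun t : ℝ => p (t • v)) 0 0 := by
    have h1 : HasDerivAt (fun t : ℝ => t • v) v 0 := by
      simpa using (hasDerivAt_id (0 : ℝ)).smul_const v
    have h2 : HasFDerivAt p (fderiv ℝ p 0) ((fun t : ℝ => t • v) 0) := by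
      simpa using hp.hasFDerivAt
    simpa only [hv] using! h2.comp_hasDerivAt (0 : ℝ) h1
  have h : ∀ s : ℝ, HasDerivAt (fun t : ℝ => p (t • v)) 0 s := by
    intro s
    -- The velocity at time `s` is the image under `T s` of the velocity at time `0`.
    have h2 : HasDerivAt (fun t : ℝ => T s (p (t • v))) 0 (s - s) := by
      rw [sub_self]
      simpa using! (T s).hasFDerivAt.comp_hasDerivAt (0 : ℝ) h0
    refine (h2.comp_sub_const s s).congr_of_eventuallyEq (Eventually.of_forall fun u => ?_)
    simp only [← hT, add_sub_cancel]
  have := is_const_of_deriv_eq_zero (fun s => (h s).differentiableAt) (fun s => (h s).deriv) t 0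
  simpa using this

theorem hasDerivAt_coe_suExp {n : ℕ} (A : su n) :
    HasDerivAt (fun t : ℝ => (suExp (t • A) : Matrix (Fin n) (Fin n) ℂ)) A 0 := by
  have h1 : HasDerivAt (fun t : ℝ => t • A) A 0 := by
    simpa using (hasDerivAt_id (0 : ℝ)).smul_const A
  have h2 : HasFDerivAt (fun A : su n => (suExp A : Matrix (Fin n) (Fin n) ℂ)) (su n).subtypeL
      ((fun t : ℝ => t • A) 0) := by
    simpa using hasFDerivAt_coe_suExp
  exact h2.comp_hasDerivAt (0 : ℝ) h1

/-- Differentiating the commutation relation at `t = 0` shows that `A` commutes with `SU(n)`; it is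
then scalar, and its trace is zero. -/
theorem eq_zero_of_suExp_mem_center {n : ℕ} (hn : 1 ≤ n) {A : su n}
    (h : ∀ t : ℝ, suExp (t • A) ∈ Subgroup.center (SU n)) : A = 0 := by
  have hcomm : ∀ U : SU n, (U : Matrix (Fin n) (Fin n) ℂ) * A = A * U := by
    intro U
    have h1 := (hasDerivAt_coe_suExp A).const_mul (U : Matrix (Fin n) (Fin n) ℂ)
    have h2 := (hasDerivAt_coe_suExp A).mul_const (U : Matrix (Fin n) (Fin n) ℂ)
    refine h1.unique (h2.congr_of_eventuallyEq (Eventually.of_forall fun t => ?_))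
    exact congrArg Subtype.val (Subgroup.mem_center_iff.1 (h t) U)
  obtain ⟨c, hc⟩ := exists_eq_smul_one_of_commute_SU hn hcomm
  have htr := (mem_su.1 A.2).2
  rw [hc, Matrix.trace_smul, Matrix.trace_one, Fintype.card_fin, smul_eq_mul, mul_eq_zero] at htr
  have hn' : (n : ℂ) ≠ 0 := by exact_mod_cast (by omega : n ≠ 0)
  refine Subtype.ext ?_
  rw [hc, htr.resolve_right hn', zero_smul, Submodule.coe_zero]

/-! ### The manifolds `SU(n)` and `SU(n) / Z_n` -/

/-- The exponential stands to the left of `U`, so that quotient and orbit maps, being equivariant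
for the left action, preserve these coordinates. -/
theorem isParamAt_SU {n : ℕ} (U : SU n) :
    IsParamAt (fun U : SU n => (U : Matrix (Fin n) (Fin n) ℂ)) (fun A : su n => suExp A * U) U where
  map_nhds := by
    have : (fun A : su n => suExp A * U) = (· * U) ∘ suExp := rfl
    rw [this, ← Filter.map_map, map_suExp_nhds,
      ← Homeomorph.coe_mulRight, (Homeomorph.mulRight U).map_nhds_eq]
    simp
  apply_zero := by rw [suExp_zero, one_mul]
  contDiff := contDiff_coe_suExp.mul contDiff_const
  injective := by
    have h : HasFDerivAt ((fun U : SU n => (U : Matrix (Fin n) (Fin n) ℂ)) ∘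
        fun A : su n => suExp A * U) _ 0 :=
      hasFDerivAt_coe_suExp.mul_const' (U : Matrix (Fin n) (Fin n) ℂ)
    rw [h.fderiv, injective_iff_map_eq_zero]
    intro A hA
    have hA' : (A : Matrix (Fin n) (Fin n) ℂ) * U = 0 := hA
    have hU := Matrix.mem_unitaryGroup_iff.1 (Matrix.mem_specialUnitaryGroup_iff.1 U.2).1
    refine Subtype.ext ?_
    rw [Submodule.coe_zero, ← mul_one (A : Matrix (Fin n) (Fin n) ℂ), ← hU, ← mul_assoc, hA',
      zero_mul]

/-- The adjoint action of a matrix. -/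
def conjMap {n : ℕ} (U : Matrix (Fin n) (Fin n) ℂ) :
    Matrix (Fin n) (Fin n) ℂ →L[ℝ] Matrix (Fin n) (Fin n) ℂ :=
  ContinuousLinearMap.mulLeftRight ℝ _ U (star U)

theorem conjMap_apply {n : ℕ} (U B : Matrix (Fin n) (Fin n) ℂ) :
    conjMap U B = U * B * star U := rfl

theorem contDiff_conjMap {n : ℕ} : ContDiff ℝ ω (conjMap (n := n)) := by
  have h : ContDiff ℝ ω (fun U : Matrix (Fin n) (Fin n) ℂ => star U) :=
    (starL' ℝ : Matrix (Fin n) (Fin n) ℂ ≃L[ℝ] _).contDiff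
  exact (ContinuousLinearMap.mulLeftRight ℝ (Matrix (Fin n) (Fin n) ℂ)).contDiff.clm_apply h

theorem conjMap_mul {n : ℕ} (U V : Matrix (Fin n) (Fin n) ℂ) :
    conjMap (U * V) = (conjMap U).comp (conjMap V) := by
  ext1 B
  simp only [ContinuousLinearMap.comp_apply, conjMap_apply, star_mul, mul_assoc]

/-- This makes the adjoint representation well defined and injective on `SU(n) / Z_n`. -/
theorem conjMap_eq_iff {n : ℕ} (hn : 1 ≤ n) {U V : SU n} :
    conjMap (U : Matrix (Fin n) (Fin n) ℂ) = conjMap (V : Matrix (Fin n) (Fin n) ℂ) ↔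
      U⁻¹ * V ∈ Subgroup.center (SU n) := by
  have hU : star (U : Matrix (Fin n) (Fin n) ℂ) * U = 1 :=
    Matrix.mem_unitaryGroup_iff'.1 (Matrix.mem_specialUnitaryGroup_iff.1 U.2).1
  have hV : star (V : Matrix (Fin n) (Fin n) ℂ) * V = 1 :=
    Matrix.mem_unitaryGroup_iff'.1 (Matrix.mem_specialUnitaryGroup_iff.1 V.2).1
  have hUV : ((U⁻¹ * V : SU n) : Matrix (Fin n) (Fin n) ℂ) =
      star (U : Matrix (Fin n) (Fin n) ℂ) * V := rfl
  constructor
  · intro h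
    refine Subgroup.mem_center_iff.2 fun W => Subtype.ext ?_
    change (W : Matrix (Fin n) (Fin n) ℂ) * (U⁻¹ * V : SU n) = (U⁻¹ * V : SU n) * W
    rw [hUV]
    have h1 := congrArg (fun T => star (U : Matrix (Fin n) (Fin n) ℂ) * T W * V) h
    simp only [conjMap_apply] at h1
    calc (W : Matrix (Fin n) (Fin n) ℂ) * (star (U : Matrix (Fin n) (Fin n) ℂ) * V)
        = star (U : Matrix (Fin n) (Fin n) ℂ) * U * W *
          (star (U : Matrix (Fin n) (Fin n) ℂ) * V) := by rw [hU, one_mul]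
      _ = star (U : Matrix (Fin n) (Fin n) ℂ) *
          (U * W * star (U : Matrix (Fin n) (Fin n) ℂ)) * V := by simp only [mul_assoc]
      _ = star (U : Matrix (Fin n) (Fin n) ℂ) * V * W *
          (star (V : Matrix (Fin n) (Fin n) ℂ) * V) := by rw [h1]; simp only [mul_assoc]
      _ = _ := by rw [hV, mul_one]
  · intro h
    obtain ⟨c, hc⟩ := (mem_center_SU_iff hn).1 h
    have hVc : (V : Matrix (Fin n) (Fin n) ℂ) = U * (U⁻¹ * V : SU n) :=
      congrArg Subtype.val (mul_inv_cancel_left U V).symm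
    have hcc := Matrix.mem_unitaryGroup_iff.1 (Matrix.mem_specialUnitaryGroup_iff.1
      (U⁻¹ * V).2).1
    rw [hVc, conjMap_mul]
    ext1 B
    have : conjMap ((U⁻¹ * V : SU n) : Matrix (Fin n) (Fin n) ℂ) B = B := by
      rw [conjMap_apply]
      conv_rhs => rw [← mul_one B, ← hcc]
      rw [← mul_assoc]
      congr 1
      rw [hc]
      simp
    rw [ContinuousLinearMap.comp_apply, this]

/-- The adjoint representation of `SU(n) / Z_n`. -/
def adjointMap {n : ℕ} (hn : 1 ≤ n) :
    PSU n → (Matrix (Fin n) (Fin n) ℂ →L[ℝ] Matrix (Fin n) (Fin n) ℂ) :=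
  Quotient.lift (fun U : SU n => conjMap (U : Matrix (Fin n) (Fin n) ℂ)) fun _ _ h =>
    (conjMap_eq_iff hn).2 (QuotientGroup.leftRel_apply.1 h)

theorem adjointMap_mk {n : ℕ} (hn : 1 ≤ n) (U : SU n) :
    adjointMap hn (QuotientGroup.mk U) = conjMap (U : Matrix (Fin n) (Fin n) ℂ) := rfl

/-- A continuous injection of a compact space into a Hausdorff space. It supplies the ambient vector
space in which `SU(n) / Z_n` is parametrized. -/
theorem isEmbedding_adjointMap {n : ℕ} (hn : 1 ≤ n) : IsEmbedding (adjointMap hn) := by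
  have hc : Continuous (adjointMap hn) :=
    continuous_quot_lift _ (contDiff_conjMap.continuous.comp continuous_subtype_val)
  have hi : Function.Injective (adjointMap hn) := by
    intro x y
    induction x using QuotientGroup.induction_on with | H U =>
    induction y using QuotientGroup.induction_on with | H V =>
    intro h
    exact QuotientGroup.eq.2 ((conjMap_eq_iff hn).1 h)
  exact (hc.isClosedEmbedding hi).isEmbedding

theorem isParamAt_PSU {n : ℕ} (hn : 1 ≤ n) (x : PSU n) :
    IsParamAt (adjointMap hn) (fun A : su n => (QuotientGroup.mk (suExp A) : PSU n) * x) x := by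
  induction x using QuotientGroup.induction_on with | H U =>
  have hfq : adjointMap hn ∘ (fun A : su n => (QuotientGroup.mk (suExp A) : PSU n) *
      QuotientGroup.mk U) =
        fun A : su n =>
        conjMap ((suExp A : Matrix (Fin n) (Fin n) ℂ) * (U : Matrix (Fin n) (Fin n) ℂ)) := by
    ext1 A
    exact adjointMap_mk hn (suExp A * U)
  have hcd : ContDiff ℝ ω fun A : su n =>
        conjMap ((suExp A : Matrix (Fin n) (Fin n) ℂ) * (U : Matrix (Fin n) (Fin n) ℂ)) :=
    contDiff_conjMap.comp (contDiff_coe_suExp.mul contDiff_const)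
  refine ⟨?_, ?_, ?_, ?_⟩
  · have : (fun A : su n => (QuotientGroup.mk (suExp A) : PSU n) * QuotientGroup.mk U) =
        (QuotientGroup.mk : SU n → PSU n) ∘ fun A : su n => suExp A * U := rfl
    rw [this, ← Filter.map_map, (isParamAt_SU U).map_nhds]
    exact QuotientGroup.isOpenQuotientMap_mk.map_nhds_eq U
  · rw [suExp_zero, QuotientGroup.mk_one, one_mul]
  · rw [hfq]
    exact hcd
  · rw [hfq, injective_iff_map_eq_zero]
    intro A hA
    have hconst := eq_of_fderiv_eq_zero (hcd.contDiffAt.differentiableAt (by simp)) hA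
      (T := fun s => ContinuousLinearMap.compL ℝ _ _ _
        (conjMap (suExp (s • A) : Matrix (Fin n) (Fin n) ℂ))) fun s t => by
        rw [suExp_add_smul, Submonoid.coe_mul, mul_assoc, conjMap_mul]
        rfl
    refine eq_zero_of_suExp_mem_center hn fun t => ?_
    have h1 := hconst t
    rw [suExp_zero] at h1
    have h2 := (conjMap_eq_iff hn (U := suExp (t • A) * U) (V := 1 * U)).1 h1
    -- After inversion the central element is `U⁻¹ * suExp (t • A) * U`; conjugation by `U` removes
    -- the outer factors.
    rw [← Subgroup.inv_mem_iff] at h2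
    have h3 := (Subgroup.instNormalCenter (G := SU n)).conj_mem _ h2 U
    simpa [mul_assoc] using h3

/-- A linear parametrization of `su(n)`. -/
def suEquiv {n : ℕ} (hn : 1 ≤ n) : EuclideanSpace ℝ (Fin (n ^ 2 - 1)) ≃L[ℝ] su n :=
  ContinuousLinearEquiv.ofFinrankEq (by rw [finrank_euclideanSpace_fin, finrank_su hn])

/-- The quotient manifold structure of `SU(n) / Z_n`, with exponential coordinates. -/
theorem exists_quotientStructure {n : ℕ} (hn : 1 ≤ n) :
    ∃ t : SmoothStructure (n ^ 2 - 1) (PSU n), IsQuotientStructure t ∧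
      t.IsParametrized fun x v => QuotientGroup.mk (suExp (suEquiv hn v)) * x := by
  obtain ⟨s, hs, hsp⟩ := exists_smoothStructure (X := SU n) Topology.IsEmbedding.subtypeVal
    fun U => (isParamAt_SU U).comp_equiv (suEquiv hn)
  obtain ⟨t, -, htp⟩ := exists_smoothStructure (isEmbedding_adjointMap hn)
    fun x => (isParamAt_PSU hn x).comp_equiv (suEquiv hn)
  exact ⟨t, ⟨s, hs, hsp.isLocalDiffeo htp fun U v => rfl⟩, htp⟩

/-! ### The center of the local unitary group -/

section Center

variable {k : ℕ} {d : Fin k → ℕ}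

theorem tensor_smul (c : Fin k → ℂ) (A : ∀ i, Matrix (Fin (d i)) (Fin (d i)) ℂ) :
    tensor (fun i => c i • A i) = (∏ i, c i) • tensor A := by
  ext a b
  simp [tensor, Finset.prod_mul_distrib]

theorem trace_tensor (A : ∀ i, Matrix (Fin (d i)) (Fin (d i)) ℂ) :
    (tensor A).trace = ∏ i, (A i).trace := by
  simp only [Matrix.trace, Matrix.diag, tensor, Matrix.of_apply, Finset.prod_univ_sum,
    Fintype.piFinset_univ]

theorem coe_tensorHom (U : ∀ i, Matrix.unitaryGroup (Fin (d i)) ℂ) :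
    (tensorHom d U : Matrix (Idx d) (Idx d) ℂ) = tensor fun i => (U i : Matrix _ _ ℂ) := rfl

/-- At multi-indices that agree outside `j`, the entries of `1 ⊗ V ⊗ 1` are those of `V`. -/
theorem eq_one_of_tensorHom_mulSingle (hd : ∀ i, 1 ≤ d i) {j : Fin k}
    {V : Matrix.unitaryGroup (Fin (d j)) ℂ} (h : tensorHom d (Pi.mulSingle j V) = 1) : V = 1 := by
  let a₀ : Idx d := fun i => ⟨0, hd i⟩
  refine Subtype.ext (Matrix.ext fun p q => ?_)
  have h1 := congrFun (congrFun (congrArg Subtype.val h) (Function.update a₀ j p))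
    (Function.update a₀ j q)
  rw [coe_tensorHom, tensor, Matrix.of_apply, Finset.prod_eq_single j] at h1
  · rw [Pi.mulSingle_eq_same, Function.update_self, Function.update_self] at h1
    rw [h1, OneMemClass.coe_one, OneMemClass.coe_one, Matrix.one_apply, Matrix.one_apply]
    exact if_congr (Function.update_injective a₀ j).eq_iff rfl rfl
  · intro i _ hi
    rw [Pi.mulSingle_eq_of_ne hi, Function.update_of_ne hi, Function.update_of_ne hi,
      OneMemClass.coe_one, Matrix.one_apply_eq]
  · simp

/-- `tensorHom` is not injective in general, since phases can move between factors, so commutation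
does not lift directly. A commutator with a unitary in the single place `j` lives in that place
alone, where `tensorHom` is injective; Schur's lemma then applies. -/
theorem exists_smul_one_of_mem_center (hd : ∀ i, 1 ≤ d i)
    {U : ∀ i, Matrix.unitaryGroup (Fin (d i)) ℂ}
    (h : (⟨tensorHom d U, U, rfl⟩ : localUnitaryGroup d) ∈ Subgroup.center (localUnitaryGroup d))
    (j : Fin k) : ∃ c : ℂ, (U j : Matrix (Fin (d j)) (Fin (d j)) ℂ) = c • (1 : Matrix _ _ ℂ) := by
  refine exists_eq_smul_one_of_commute_unitary fun V hV => ?_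
  let V' : Matrix.unitaryGroup (Fin (d j)) ℂ := ⟨V, hV⟩
  have h1 : tensorHom d (Pi.mulSingle j V') * tensorHom d U =
      tensorHom d U * tensorHom d (Pi.mulSingle j V') :=
    congrArg Subtype.val (Subgroup.mem_center_iff.1 h ⟨tensorHom d (Pi.mulSingle j V'), _, rfl⟩)
  have h2 : tensorHom d (Pi.mulSingle j (V' * U j * V'⁻¹ * (U j)⁻¹)) = 1 := by
    have : (Pi.mulSingle j (V' * U j * V'⁻¹ * (U j)⁻¹) :
        ∀ i, Matrix.unitaryGroup (Fin (d i)) ℂ) =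
        Pi.mulSingle j V' * U * (Pi.mulSingle j V')⁻¹ * U⁻¹ := by
      funext i
      by_cases hi : i = j
      · subst hi
        simp
      · simp [Pi.mulSingle_eq_of_ne hi]
    rw [this, map_mul, map_mul, map_mul, h1, map_inv, map_inv]
    group
  have h3 := eq_one_of_tensorHom_mulSingle hd h2
  have h4 : V' * U j = U j * V' := by
    rwa [mul_inv_eq_one, mul_inv_eq_iff_eq_mul] at h3
  exact congrArg Subtype.val h4

theorem mem_center_of_eq_smul_one {g : localUnitaryGroup d} {c : ℂ}
    (hc : (g.1.1 : Matrix (Idx d) (Idx d) ℂ) = c • (1 : Matrix (Idx d) (Idx d) ℂ)) :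
    g ∈ Subgroup.center (localUnitaryGroup d) := by
  refine Subgroup.mem_center_iff.2 fun h => Subtype.ext (Subtype.ext ?_)
  change h.1.1 * g.1.1 = g.1.1 * h.1.1
  rw [hc]
  simp

theorem tensor_eq_smul_one {A : ∀ i, Matrix (Fin (d i)) (Fin (d i)) ℂ} {c : Fin k → ℂ}
    (h : ∀ i, A i = c i • (1 : Matrix _ _ ℂ)) : tensor A = (∏ i, c i) • (1 : Matrix _ _ ℂ) := by
  rw [show A = fun i => c i • 1 from funext h, tensor_smul, tensor_one]

theorem mem_stabilizer_iff {W : State d} {g : localUnitaryGroup d} :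
    g ∈ MulAction.stabilizer (localUnitaryGroup d) W ↔
      (g.1.1 : Matrix (Idx d) (Idx d) ℂ) * W.op = W.op * g.1.1 := by
  have h1 := Matrix.mem_unitaryGroup_iff.1 g.1.2
  have h2 := Matrix.mem_unitaryGroup_iff'.1 g.1.2
  have hext : g • W = W ↔ (g • W).op = W.op := Subtype.ext_iff
  rw [MulAction.mem_stabilizer_iff, hext, smul_op]
  constructor
  · intro h
    rw [← h, mul_assoc _ (star _), h2, mul_one, h]
  · intro h
    rw [h, mul_assoc, h1, mul_one]

theorem center_le_stabilizer (hd : ∀ i, 1 ≤ d i) (W : State d) :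
    Subgroup.center (localUnitaryGroup d) ≤ MulAction.stabilizer (localUnitaryGroup d) W := by
  rintro ⟨_, U, rfl⟩ hg
  choose c hc using exists_smul_one_of_mem_center hd hg
  rw [mem_stabilizer_iff, coe_tensorHom, tensor_eq_smul_one hc]
  simp

end Center

/-! ### A state whose isotropy subgroup is the center -/

section Witness

/-- Distinct real numbers, with sum zero. -/
def level (n : ℕ) (p : Fin n) : ℝ := n * (p : ℕ) - ∑ q : Fin n, ((q : ℕ) : ℝ)

theorem sum_level (n : ℕ) : ∑ p, level n p = 0 := by
  simp [level, Finset.sum_sub_distrib, ← Finset.mul_sum]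

theorem level_injective (n : ℕ) : Function.Injective (level n) := by
  intro p q h
  have hn : (n : ℝ) ≠ 0 := by exact_mod_cast (by have := p.2; omega : n ≠ 0)
  simp only [level, sub_left_inj] at h
  exact Fin.ext (by exact_mod_cast mul_left_cancel₀ hn h)

/-- The corner entry of `mixMatrix` is nonzero, which later allows the other tensor factors to be
cancelled. -/
theorem level_zero_ne {n : ℕ} (hn : 2 ≤ n) : level n ⟨0, by omega⟩ ≠ 0 := by
  have h : (0 : ℝ) < ∑ q : Fin n, ((q : ℕ) : ℝ) :=
    Finset.sum_pos' (fun q _ => Nat.cast_nonneg _) ⟨⟨1, by omega⟩, Finset.mem_univ _, by simp⟩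
  simp only [level, Nat.cast_zero, mul_zero, zero_sub]
  linarith [neg_ne_zero.2 h.ne']

/-- A diagonal observable with simple spectrum and trace zero. -/
def levelMatrix (n : ℕ) : Matrix (Fin n) (Fin n) ℂ := Matrix.diagonal fun p => (level n p : ℂ)

/-- An observable of trace zero without zeros off the diagonal. -/
def mixMatrix (n : ℕ) : Matrix (Fin n) (Fin n) ℂ :=
  Matrix.of fun p q => if p = q then (level n p : ℂ) else 1

theorem star_levelMatrix (n : ℕ) : star (levelMatrix n) = levelMatrix n := by
  rw [levelMatrix, Matrix.star_eq_conjTranspose, Matrix.diagonal_conjTranspose]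
  congr 1
  ext p
  simp

theorem star_mixMatrix (n : ℕ) : star (mixMatrix n) = mixMatrix n := by
  ext p q
  rw [Matrix.star_apply, mixMatrix, Matrix.of_apply, Matrix.of_apply]
  by_cases h : p = q
  · subst h; simp
  · simp [h, Ne.symm h]

theorem trace_levelMatrix (n : ℕ) : (levelMatrix n).trace = 0 := by
  rw [levelMatrix, Matrix.trace_diagonal]
  exact_mod_cast sum_level n

theorem trace_mixMatrix (n : ℕ) : (mixMatrix n).trace = 0 := by
  simp only [Matrix.trace, Matrix.diag, mixMatrix, Matrix.of_apply, if_true]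
  exact_mod_cast sum_level n

variable {k : ℕ} {d : Fin k → ℕ}

/-- The operator `1 ⊗ ⋯ ⊗ B ⊗ ⋯ ⊗ 1` with `B` in the `j`-th place. -/
def localOp (j : Fin k) (B : Matrix (Fin (d j)) (Fin (d j)) ℂ) : Matrix (Idx d) (Idx d) ℂ :=
  tensor (Function.update (fun _ => 1) j B)

theorem star_tensor (A : ∀ i, Matrix (Fin (d i)) (Fin (d i)) ℂ) :
    star (tensor A) = tensor fun i => star (A i) := (tensor_star A).symm

theorem tensor_conj_localOp (U : ∀ i, Matrix.unitaryGroup (Fin (d i)) ℂ) (j : Fin k)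
    (B : Matrix (Fin (d j)) (Fin (d j)) ℂ) :
    star (tensor fun i => (U i : Matrix (Fin (d i)) (Fin (d i)) ℂ)) * localOp j B *
      (tensor fun i => (U i : Matrix (Fin (d i)) (Fin (d i)) ℂ)) =
      localOp j (star (U j : Matrix (Fin (d j)) (Fin (d j)) ℂ) * B *
        (U j : Matrix (Fin (d j)) (Fin (d j)) ℂ)) := by
  rw [star_tensor, localOp, localOp, ← tensor_mul, ← tensor_mul]
  congr 1
  funext i
  by_cases hi : i = j
  · subst hi; simp
  · rw [Function.update_of_ne hi, Function.update_of_ne hi, mul_one]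
    exact Matrix.mem_unitaryGroup_iff'.1 (U i).2

/-- The sum of local observables with simple spectrum and of a product observable. -/
def witnessOp (d : Fin k → ℕ) : Matrix (Idx d) (Idx d) ℂ :=
  ∑ j, localOp j (levelMatrix (d j)) + tensor fun i => mixMatrix (d i)

theorem isSelfAdjoint_witnessOp (d : Fin k → ℕ) : IsSelfAdjoint (witnessOp d) := by
  rw [IsSelfAdjoint, witnessOp, star_add, star_sum, star_tensor]
  congr 1
  · refine Finset.sum_congr rfl fun j _ => ?_
    rw [localOp, star_tensor]
    congr 1
    funext i
    by_cases hi : i = j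
    · subst hi; simp [star_levelMatrix]
    · simp [Function.update_of_ne hi]
  · simp only [star_mixMatrix]

/-- The pairing computes the partial trace onto party `j`. Every other summand has a factor of trace
zero; for the product term this factor sits at some `i ≠ j`, which exists because `2 ≤ k`. -/
theorem trace_witnessOp_mul (hk : 2 ≤ k) (j : Fin k) (B : Matrix (Fin (d j)) (Fin (d j)) ℂ) :
    (witnessOp d * localOp j B).trace =
      (levelMatrix (d j) * B).trace * ∏ i ∈ Finset.univ.erase j, (d i : ℂ) := by
  rw [witnessOp, add_mul, Finset.sum_mul, Matrix.trace_add, Matrix.trace_sum,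
    Finset.sum_eq_single j]
  · have h1 : ((tensor fun i => mixMatrix (d i)) * localOp j B).trace = 0 := by
      obtain ⟨i, hi⟩ : ∃ i : Fin k, i ≠ j := by
        have : Nontrivial (Fin k) := Fin.nontrivial_iff_two_le.2 hk
        exact exists_ne j
      rw [localOp, ← tensor_mul, trace_tensor]
      refine Finset.prod_eq_zero (Finset.mem_univ i) ?_
      rw [Function.update_of_ne hi, mul_one, trace_mixMatrix]
    rw [h1, add_zero, localOp, localOp, ← tensor_mul, trace_tensor,
      ← Finset.mul_prod_erase _ _ (Finset.mem_univ j), Function.update_self, Function.update_self]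
    congr 1
    refine Finset.prod_congr rfl fun i hi => ?_
    rw [Function.update_of_ne (Finset.ne_of_mem_erase hi),
      Function.update_of_ne (Finset.ne_of_mem_erase hi), mul_one, Matrix.trace_one,
      Fintype.card_fin]
  · intro i _ hi
    rw [localOp, localOp, ← tensor_mul, trace_tensor]
    refine Finset.prod_eq_zero (Finset.mem_univ i) ?_
    rw [Function.update_self, Function.update_of_ne hi, mul_one, trace_levelMatrix]
  · simp

theorem trace_witnessOp (hk : 2 ≤ k) : (witnessOp d).trace = 0 := by
  have h := trace_witnessOp_mul (d := d) hk ⟨0, by omega⟩ 1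
  have h1 : localOp (d := d) (⟨0, by omega⟩ : Fin k) 1 = 1 := by
    rw [localOp, ← tensor_one]
    congr 1
    exact Function.update_eq_self _ _
  rwa [h1, mul_one, mul_one, trace_levelMatrix, zero_mul] at h

theorem exists_smul_one_of_commute_witnessOp (hk : 2 ≤ k) (hd : ∀ i, 2 ≤ d i)
    (U : ∀ i, Matrix.unitaryGroup (Fin (d i)) ℂ)
    (h : (tensor fun i => (U i : Matrix (Fin (d i)) (Fin (d i)) ℂ)) * witnessOp d =
      witnessOp d * tensor fun i => (U i : Matrix (Fin (d i)) (Fin (d i)) ℂ)) (j : Fin k) :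
    ∃ c : ℂ, (U j : Matrix (Fin (d j)) (Fin (d j)) ℂ) = c • (1 : Matrix _ _ ℂ) := by
  have hUU : (tensor fun i => (U i : Matrix (Fin (d i)) (Fin (d i)) ℂ)) *
      star (tensor fun i => (U i : Matrix (Fin (d i)) (Fin (d i)) ℂ)) = 1 :=
    Matrix.mem_unitaryGroup_iff.1 (tensorHom d U).2
  set T := tensor fun i => (U i : Matrix (Fin (d i)) (Fin (d i)) ℂ) with hT
  have hconj : T * witnessOp d * star T = witnessOp d := by rw [h, mul_assoc, hUU, mul_one]
  have hcomm : ∀ j, (U j : Matrix (Fin (d j)) (Fin (d j)) ℂ) * levelMatrix (d j) =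
      levelMatrix (d j) * U j := by
    intro j
    have hγ : (∏ i ∈ Finset.univ.erase j, (d i : ℂ)) ≠ 0 :=
      Finset.prod_ne_zero_iff.2 fun i _ => by
        exact_mod_cast (by have := hd i; omega : d i ≠ 0)
    have key : (U j : Matrix (Fin (d j)) (Fin (d j)) ℂ) * levelMatrix (d j) *
        star (U j : Matrix (Fin (d j)) (Fin (d j)) ℂ) = levelMatrix (d j) := by
      -- The trace pairing is nondegenerate, and its cyclicity moves the conjugation from `witnessOp
      -- d` to the test operator `B`.
      rw [Matrix.ext_iff_trace_mul_right]
      intro B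
      have h1 : (witnessOp d * localOp j B).trace = (witnessOp d *
          localOp j (star (U j : Matrix (Fin (d j)) (Fin (d j)) ℂ) * B *
            (U j : Matrix (Fin (d j)) (Fin (d j)) ℂ))).trace := by
        rw [← tensor_conj_localOp, ← hT]
        conv_lhs => rw [← hconj]
        rw [mul_assoc, mul_assoc, Matrix.trace_mul_comm]
        simp only [mul_assoc]
      rw [trace_witnessOp_mul hk, trace_witnessOp_mul hk] at h1
      rw [mul_right_cancel₀ hγ h1, mul_assoc, mul_assoc, Matrix.trace_mul_comm]
      simp only [mul_assoc]
    have hUj := Matrix.mem_unitaryGroup_iff'.1 (U j).2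
    conv_rhs => rw [← key]
    rw [mul_assoc _ (star _), hUj, mul_one]
  -- Commuting with a diagonal matrix of distinct entries forces diagonality.
  have hoff : ∀ i p q, p ≠ q → (U i : Matrix (Fin (d i)) (Fin (d i)) ℂ) p q = 0 := by
    intro i p q hpq
    have h1 := congrFun (congrFun (hcomm i) p) q
    rw [levelMatrix, Matrix.mul_diagonal, Matrix.diagonal_mul, mul_comm, ← sub_eq_zero,
      ← sub_mul, mul_eq_zero, sub_eq_zero] at h1
    refine h1.resolve_left fun h2 => hpq ?_
    exact (level_injective (d i) (by exact_mod_cast h2)).symm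
  have hdiag : ∀ i, (U i : Matrix (Fin (d i)) (Fin (d i)) ℂ) =
      Matrix.diagonal fun p => (U i : Matrix (Fin (d i)) (Fin (d i)) ℂ) p p := by
    intro i
    ext p q
    by_cases hpq : p = q
    · subst hpq; simp
    · rw [hoff i p q hpq, Matrix.diagonal_apply_ne _ hpq]
  have hne : ∀ i p, (U i : Matrix (Fin (d i)) (Fin (d i)) ℂ) p p ≠ 0 := by
    intro i p hp
    have h1 := congrFun (congrFun (Matrix.mem_unitaryGroup_iff.1 (U i).2) p) p
    rw [hdiag i, Matrix.diagonal_mul, hp, zero_mul, Matrix.one_apply_eq] at h1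
    exact zero_ne_one h1
  -- The local summands commute with `T` one by one, so commutation with the product term is what
  -- remains.
  have hmix : (tensor fun i => (U i : Matrix (Fin (d i)) (Fin (d i)) ℂ) * mixMatrix (d i)) =
      tensor fun i => mixMatrix (d i) * (U i : Matrix (Fin (d i)) (Fin (d i)) ℂ) := by
    have h1 : ∀ j, T * localOp j (levelMatrix (d j)) = localOp j (levelMatrix (d j)) * T := by
      intro j
      rw [hT, localOp, ← tensor_mul, ← tensor_mul]
      congr 1
      funext i
      by_cases hi : i = j
      · subst hi
        rw [Function.update_self, hcomm]
      · rw [Function.update_of_ne hi, mul_one, one_mul]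
    rw [witnessOp, mul_add, add_mul, Finset.mul_sum, Finset.sum_mul,
      Finset.sum_congr rfl fun j _ => h1 j, add_right_inj, hT, ← tensor_mul, ← tensor_mul] at h
    exact h
  have hd1 : ∀ i, 0 < d i := fun i => by have := hd i; omega
  let a₀ : Idx d := fun i => ⟨0, hd1 i⟩
  have heq : ∀ p q, (U j : Matrix (Fin (d j)) (Fin (d j)) ℂ) p p =
      (U j : Matrix (Fin (d j)) (Fin (d j)) ℂ) q q := by
    intro p q
    by_cases hpq : p = q
    · rw [hpq]
    -- The two multi-indices differ only in place `j`. Elsewhere both sides contribute the same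
    -- nonzero corner entries; in place `j` the entry of `mixMatrix` is `1`, leaving the two
    -- diagonal entries of `U j`.
    have h1 := congrFun (congrFun hmix (Function.update a₀ j p)) (Function.update a₀ j q)
    simp only [tensor, Matrix.of_apply] at h1
    rw [← Finset.mul_prod_erase _ _ (Finset.mem_univ j),
      ← Finset.mul_prod_erase _ _ (Finset.mem_univ j)] at h1
    have h2 : ∏ i ∈ Finset.univ.erase j, (mixMatrix (d i) *
        (U i : Matrix (Fin (d i)) (Fin (d i)) ℂ)) (Function.update a₀ j p i)
          (Function.update a₀ j q i) = ∏ i ∈ Finset.univ.erase j,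
        ((U i : Matrix (Fin (d i)) (Fin (d i)) ℂ) * mixMatrix (d i)) (Function.update a₀ j p i)
          (Function.update a₀ j q i) := by
      refine Finset.prod_congr rfl fun i hi => ?_
      rw [Function.update_of_ne (Finset.ne_of_mem_erase hi),
        Function.update_of_ne (Finset.ne_of_mem_erase hi), hdiag i, Matrix.diagonal_mul,
        Matrix.mul_diagonal, mul_comm]
    have h3 : ∏ i ∈ Finset.univ.erase j,
        ((U i : Matrix (Fin (d i)) (Fin (d i)) ℂ) * mixMatrix (d i)) (Function.update a₀ j p i)
          (Function.update a₀ j q i) ≠ 0 := by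
      refine Finset.prod_ne_zero_iff.2 fun i hi => ?_
      rw [Function.update_of_ne (Finset.ne_of_mem_erase hi),
        Function.update_of_ne (Finset.ne_of_mem_erase hi), hdiag i, Matrix.diagonal_mul]
      refine mul_ne_zero (hne i _) ?_
      simp only [mixMatrix, Matrix.of_apply, if_true]
      exact_mod_cast level_zero_ne (hd i)
    rw [h2] at h1
    have h4 := mul_right_cancel₀ h3 h1
    rw [Function.update_self, Function.update_self, hdiag j, Matrix.diagonal_mul,
      Matrix.mul_diagonal, mixMatrix, Matrix.of_apply, if_neg hpq, mul_one, one_mul] at h4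
    exact h4
  refine ⟨(U j : Matrix (Fin (d j)) (Fin (d j)) ℂ) ⟨0, hd1 j⟩ ⟨0, hd1 j⟩, ?_⟩
  rw [Matrix.smul_one_eq_diagonal]
  conv_lhs => rw [hdiag j]
  congr 1
  funext p
  exact heq p _

-- Adding a multiple of the identity and rescaling do not change which unitaries commute with an
-- operator, so `witnessOp d` may be turned into a state.
open scoped MatrixOrder in
theorem exists_state_stabilizer_eq_center (hk : 2 ≤ k) (hd : ∀ i, 2 ≤ d i) :
    ∃ W : State d, MulAction.stabilizer (localUnitaryGroup d) W =
      Subgroup.center (localUnitaryGroup d) := by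
  have hd1 : ∀ i, 1 ≤ d i := fun i => by have := hd i; omega
  -- The norm makes the shifted operator positive; the extra `1` keeps its trace `r * N` nonzero
  -- even if the norm vanishes.
  let r : ℝ := ‖witnessOp d‖ + 1
  have hr : 0 < r := by positivity
  let N : ℝ := Fintype.card (Idx d)
  have hN : 0 < N := by
    have : Nonempty (Idx d) := ⟨fun i => ⟨0, hd1 i⟩⟩
    exact Nat.cast_pos.2 Fintype.card_pos
  let P : Matrix (Idx d) (Idx d) ℂ := algebraMap ℝ _ r + witnessOp d
  have hP : P.PosSemidef := by
    rw [← Matrix.nonneg_iff_posSemidef]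
    have h1 := (isSelfAdjoint_witnessOp d).neg_algebraMap_norm_le_self
    have h2 : (0 : Matrix (Idx d) (Idx d) ℂ) ≤ algebraMap ℝ _ 1 := by
      rw [map_one]; exact Matrix.PosSemidef.one.nonneg
    have h3 := add_nonneg h2 (sub_nonneg.2 h1)
    refine h3.trans_eq ?_
    simp only [P, r, map_add, sub_neg_eq_add]
    abel
  have htr : P.trace = ((r * N : ℝ) : ℂ) := by
    rw [Matrix.trace_add, trace_witnessOp hk, add_zero, Algebra.algebraMap_eq_smul_one,
      Matrix.trace_smul, Matrix.trace_one]
    simp [N]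
  have hpos : 0 < r * N := mul_pos hr hN
  let W : State d := ⟨(((r * N)⁻¹ : ℝ) : ℂ) • P, hP.smul (by
      rw [Complex.zero_le_real]; positivity), by
    rw [Matrix.trace_smul, htr, smul_eq_mul, ← Complex.ofReal_mul, inv_mul_cancel₀ hpos.ne',
      Complex.ofReal_one]⟩
  refine ⟨W, le_antisymm ?_ (center_le_stabilizer hd1 W)⟩
  rintro ⟨_, U, rfl⟩ hg
  have h1 := mem_stabilizer_iff.1 hg
  change (tensor fun i => (U i : Matrix (Fin (d i)) (Fin (d i)) ℂ)) *
    ((((r * N)⁻¹ : ℝ) : ℂ) • P) = ((((r * N)⁻¹ : ℝ) : ℂ) • P) *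
    (tensor fun i => (U i : Matrix (Fin (d i)) (Fin (d i)) ℂ)) at h1
  have hne : (((r * N)⁻¹ : ℝ) : ℂ) ≠ 0 := by exact_mod_cast (inv_pos.2 hpos).ne'
  rw [mul_smul_comm, smul_mul_assoc, smul_right_inj hne, mul_add, add_mul,
    Algebra.commutes r (tensor fun i => (U i : Matrix (Fin (d i)) (Fin (d i)) ℂ)),
    add_right_inj] at h1
  choose c hc using exists_smul_one_of_commute_witnessOp hk hd U h1
  exact mem_center_of_eq_smul_one (tensor_eq_smul_one hc)

end Witness

/-! ### Exponential coordinates of the product of the special unitary groups -/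

section Exp

variable {k : ℕ} {d : Fin k → ℕ}

/-- The exponential map of `∏ i, SU(d i)`. -/
def piExp (A : ∀ i, su (d i)) : ∀ i, SU (d i) := fun i => suExp (A i)

theorem piExp_zero : piExp (0 : ∀ i, su (d i)) = 1 := funext fun _ => suExp_zero

theorem piExp_add_smul (A : ∀ i, su (d i)) (s t : ℝ) :
    piExp ((s + t) • A) = piExp (s • A) * piExp (t • A) := funext fun i => suExp_add_smul (A i) s t

theorem map_piExp_nhds : map piExp (𝓝 (0 : ∀ i, su (d i))) = 𝓝 1 := by
  have h : (piExp : (∀ i, su (d i)) → ∀ i, SU (d i)) = Pi.map fun _ => suExp := rfl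
  rw [h, nhds_pi, nhds_pi, map_piMap_pi_finite]
  congr 1
  funext i
  exact map_suExp_nhds

/-- The inclusion of `∏ i, SU(d i)` into the product of the matrix algebras. -/
def piCoe (U : ∀ i, SU (d i)) : ∀ i, Matrix (Fin (d i)) (Fin (d i)) ℂ := fun i => U i

theorem isEmbedding_piCoe : IsEmbedding (piCoe (d := d)) :=
  IsEmbedding.piMap fun _ => IsEmbedding.subtypeVal

theorem hasFDerivAt_piCoe_piExp :
    HasFDerivAt (fun A : ∀ i, su (d i) => piCoe (piExp A))
      (ContinuousLinearMap.pi fun i => (su (d i)).subtypeL.comp (ContinuousLinearMap.proj i)) 0 := by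
  refine hasFDerivAt_pi.2 fun i => ?_
  have h : HasFDerivAt (fun A : su (d i) => (suExp A : Matrix (Fin (d i)) (Fin (d i)) ℂ))
      (su (d i)).subtypeL ((ContinuousLinearMap.proj (R := ℝ) (φ := fun i => su (d i)) i) 0) := by
    rw [map_zero]
    exact hasFDerivAt_coe_suExp
  exact h.comp (0 : ∀ i, su (d i))
    (ContinuousLinearMap.proj (R := ℝ) (φ := fun i => su (d i)) i).hasFDerivAt

theorem contDiff_piCoe_piExp : ContDiff ℝ ω (fun A : ∀ i, su (d i) => piCoe (piExp A)) :=
  contDiff_pi.2 fun i => contDiff_coe_suExp.comp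
    (ContinuousLinearMap.proj (R := ℝ) (φ := fun i => su (d i)) i).contDiff

theorem isParamAt_piExp : IsParamAt (piCoe (d := d)) piExp 1 where
  map_nhds := map_piExp_nhds
  apply_zero := piExp_zero
  contDiff := contDiff_piCoe_piExp
  injective := by
    have h : HasFDerivAt (piCoe ∘ piExp) _ (0 : ∀ i, su (d i)) := hasFDerivAt_piCoe_piExp
    rw [h.fderiv]
    intro A B hAB
    funext i
    exact Subtype.ext (congrFun hAB i)

/-- Complementary subspaces of the Lie algebra provide coordinates of the second kind. -/
theorem map_piExp_mul_nhds {m h : Submodule ℝ (∀ i, su (d i))} (hmh : IsCompl m h) :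
    map (fun z : m × h => piExp (z.1 : ∀ i, su (d i)) * piExp (z.2 : ∀ i, su (d i))) (𝓝 0) =
      𝓝 1 :=
  isParamAt_piExp.map_mul_nhds isEmbedding_piCoe rfl (fun _ _ => rfl) hmh

theorem finrank_pi_su (hd : ∀ i, 1 ≤ d i) :
    finrank ℝ (∀ i, su (d i)) = (∑ i, d i ^ 2) - k := by
  rw [finrank_pi_fintype, Finset.sum_congr rfl fun i _ => finrank_su (hd i),
    Finset.sum_tsub_distrib _ fun i _ => Nat.one_le_pow _ _ (hd i)]
  simp

end Exp

/-! ### Orbits of the local unitary group -/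

section OrbitGeometry

variable {k : ℕ} {d : Fin k → ℕ}

/-- The homomorphism `(U₁, …, U_k) ↦ U₁ ⊗ ⋯ ⊗ U_k` on `∏ i, SU(d i)`. -/
def localSU (d : Fin k → ℕ) : (∀ i, SU (d i)) →* localUnitaryGroup d :=
  (tensorHom d).rangeRestrict.comp (MonoidHom.pi fun i =>
    (Submonoid.inclusion Matrix.specialUnitaryGroup_le_unitaryGroup).comp
      (Pi.evalMonoidHom (fun i => SU (d i)) i))

instance (W : State d) : MulAction (∀ i, SU (d i)) (Orbit W) :=
  MulAction.compHom (Orbit W) (localSU d)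

theorem coe_pi_smul {W : State d} (U : ∀ i, SU (d i)) (x : Orbit W) :
    ((U • x : Orbit W) : State d) = localSU d U • (x : State d) := rfl

/-- Conjugation by a tensor product of matrices. -/
def tensorConj (A : ∀ i, Matrix (Fin (d i)) (Fin (d i)) ℂ) :
    Matrix (Idx d) (Idx d) ℂ →L[ℝ] Matrix (Idx d) (Idx d) ℂ :=
  ContinuousLinearMap.mulLeftRight ℝ _ (tensor A) (star (tensor A))

theorem tensorConj_apply (A : ∀ i, Matrix (Fin (d i)) (Fin (d i)) ℂ)
    (B : Matrix (Idx d) (Idx d) ℂ) : tensorConj A B = tensor A * B * star (tensor A) := rfl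

theorem orbitIncl_smul {W : State d} (U : ∀ i, SU (d i)) (x : Orbit W) :
    orbitIncl W (U • x) = tensorConj (piCoe U) (orbitIncl W x) := rfl

theorem isEmbedding_orbitIncl (W : State d) : IsEmbedding (orbitIncl W) := by
  have h : IsEmbedding (State.op (d := d)) := ⟨⟨rfl⟩, fun _ _ h => Subtype.ext h⟩
  exact h.comp IsEmbedding.subtypeVal

/-- The norm is the operator norm rather than a product norm, so smoothness is recovered from the
entries through the expansion in matrix units. -/
theorem contDiff_matrix {V ι : Type*} [NormedAddCommGroup V] [NormedSpace ℝ V] [Fintype ι]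
    [DecidableEq ι] {F : V → Matrix ι ι ℂ} (h : ∀ a b, ContDiff ℝ ω fun v => F v a b) :
    ContDiff ℝ ω F := by
  have hF : F = fun v => ∑ a, ∑ b,
      (Matrix.singleLinearMap ℝ a b).toContinuousLinearMap (F v a b) := by
    funext v
    exact Matrix.matrix_eq_sum_single (F v)
  rw [hF]
  exact ContDiff.sum fun a _ => ContDiff.sum fun b _ =>
    (ContinuousLinearMap.contDiff _).comp (h a b)

theorem contDiff_matrix_apply {ι : Type*} [Fintype ι] [DecidableEq ι] (a b : ι) :
    ContDiff ℝ ω fun A : Matrix ι ι ℂ => A a b :=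
  (Matrix.entryLinearMap ℝ ℂ a b).toContinuousLinearMap.contDiff

theorem contDiff_tensor : ContDiff ℝ ω (tensor (d := d)) := by
  refine contDiff_matrix fun a b => ?_
  simp only [tensor, Matrix.of_apply]
  refine contDiff_prod fun i _ => (contDiff_matrix_apply (a i) (b i)).comp ?_
  exact (ContinuousLinearMap.proj (R := ℝ)
    (φ := fun i => Matrix (Fin (d i)) (Fin (d i)) ℂ) i).contDiff

theorem contDiff_tensorConj : ContDiff ℝ ω (tensorConj (d := d)) := by
  have h : ContDiff ℝ ω (fun U : Matrix (Idx d) (Idx d) ℂ => star U) :=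
    (starL' ℝ : Matrix (Idx d) (Idx d) ℂ ≃L[ℝ] _).contDiff
  exact ((ContinuousLinearMap.mulLeftRight ℝ (Matrix (Idx d) (Idx d) ℂ)).contDiff.comp
    contDiff_tensor).clm_apply (h.comp contDiff_tensor)

instance (W : State d) : ContinuousSMul (∀ i, SU (d i)) (Orbit W) where
  continuous_smul := by
    rw [(isEmbedding_orbitIncl W).continuous_iff]
    have h1 : Continuous fun z : (∀ i, SU (d i)) × Orbit W => tensorConj (piCoe z.1) :=
      contDiff_tensorConj.continuous.comp (isEmbedding_piCoe.continuous.comp continuous_fst)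
    exact h1.clm_apply ((isEmbedding_orbitIncl W).continuous.comp continuous_snd)

theorem pi_isPretransitive (hd : ∀ i, 1 ≤ d i) (W : State d) :
    MulAction.IsPretransitive (∀ i, SU (d i)) (Orbit W) where
  exists_smul_eq x y := by
    obtain ⟨⟨_, U, rfl⟩, hg⟩ := MulAction.exists_smul_eq (localUnitaryGroup d) x y
    choose c S hc hS using fun i => exists_phase (hd i) (U i).2
    refine ⟨S, ?_⟩
    rw [← hg]
    refine (isEmbedding_orbitIncl W).injective ?_
    have hU : (tensor fun i => (U i : Matrix (Fin (d i)) (Fin (d i)) ℂ)) =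
        (∏ i, c i) • tensor (piCoe S) := by
      rw [← tensor_smul]
      exact congrArg tensor (funext hS)
    have hn : (∏ i, c i) * star (∏ i, c i) = 1 := by
      rw [Complex.star_def, Complex.mul_conj, Complex.normSq_eq_norm_sq, norm_prod]
      simp [hc]
    change tensor (piCoe S) * orbitIncl W x * star (tensor (piCoe S)) =
      (tensor fun i => (U i : Matrix (Fin (d i)) (Fin (d i)) ℂ)) * orbitIncl W x *
        star (tensor fun i => (U i : Matrix (Fin (d i)) (Fin (d i)) ℂ))
    rw [hU, star_smul, smul_mul_assoc, smul_mul_smul_comm, hn, one_smul]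

/-- The orbit is compact Hausdorff, hence a Baire space, and a continuous transitive action of a
σ-compact group on such a space has open orbit maps. -/
theorem map_smul_nhds (hd : ∀ i, 1 ≤ d i) {W : State d} (x : Orbit W) :
    map (fun U : ∀ i, SU (d i) => U • x) (𝓝 1) = 𝓝 x := by
  have := pi_isPretransitive hd W
  have : T2Space (Orbit W) := (isEmbedding_orbitIncl W).t2Space
  have hc : Continuous fun U : ∀ i, SU (d i) => U • x := by fun_prop
  have hs : Function.Surjective fun U : ∀ i, SU (d i) => U • x := MulAction.surjective_smul _ x
  have : CompactSpace (Orbit W) := ⟨by rw [← hs.range_eq]; exact isCompact_range hc⟩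
  refine le_antisymm ?_ ?_
  · have h := hc.tendsto 1
    rwa [one_smul] at h
  · simpa using (isOpenMap_smul_of_sigmaCompact x).nhds_le (1 : ∀ i, SU (d i))

/-- The orbit map in exponential coordinates. -/
def orbitExp {W : State d} (x : Orbit W) (A : ∀ i, su (d i)) : Orbit W := piExp A • x

theorem contDiff_orbitExp {W : State d} (x : Orbit W) :
    ContDiff ℝ ω (orbitIncl W ∘ orbitExp x) :=
  (contDiff_tensorConj.comp contDiff_piCoe_piExp).clm_apply contDiff_const

theorem tensorConj_mul (A B : ∀ i, Matrix (Fin (d i)) (Fin (d i)) ℂ) :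
    tensorConj (A * B) = (tensorConj A).comp (tensorConj B) := by
  ext1 M
  rw [ContinuousLinearMap.comp_apply, tensorConj_apply, tensorConj_apply, tensorConj_apply,
    show tensor (A * B) = tensor A * tensor B from tensor_mul A B, star_mul]
  simp only [mul_assoc]

/-- An infinitesimal stabilizer integrates to an actual one, because the orbit curve is moved by
linear conjugations. -/
theorem orbitExp_eq_of_fderiv_eq_zero {W : State d} {x : Orbit W} {A : ∀ i, su (d i)}
    (hA : fderiv ℝ (orbitIncl W ∘ orbitExp x) 0 A = 0) (t : ℝ) : piExp (t • A) • x = x := by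
  have h := eq_of_fderiv_eq_zero ((contDiff_orbitExp x).contDiffAt.differentiableAt (by simp)) hA
    (T := fun s => tensorConj (piCoe (piExp (s • A)))) (fun s t => by
      simp only [Function.comp_apply, orbitExp]
      rw [piExp_add_smul, mul_smul, orbitIncl_smul]) t
  have h2 := (isEmbedding_orbitIncl W).injective h
  simpa only [orbitExp, piExp_zero, one_smul] using h2

/-- Exponential coordinates at a point of an arbitrary orbit, on a complement of the Lie algebra of
the isotropy subgroup. -/
theorem exists_isParamAt_orbit (hd : ∀ i, 1 ≤ d i) {W : State d} (x : Orbit W) :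
    ∃ n ≤ (∑ i, d i ^ 2) - k, ∃ q : EuclideanSpace ℝ (Fin n) → Orbit W,
      IsParamAt (orbitIncl W) q x := by
  rw [← finrank_pi_su hd]
  refine exists_isParamAt_of_isCompl (p := orbitExp x) (by simp [orbitExp, piExp_zero])
    (contDiff_orbitExp x) fun m h hmh hker => ?_
  have h1 := map_smul_nhds hd x
  -- Near `1` group elements factor as `piExp z.1 * piExp z.2`, and the second factor, coming from
  -- the kernel, fixes `x`.
  rw [← map_piExp_mul_nhds hmh, Filter.map_map] at h1
  rw [← h1]
  congr 1
  funext z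
  have h2 := orbitExp_eq_of_fderiv_eq_zero (x := x) (hker _ z.2.2) 1
  rw [one_smul] at h2
  simp only [Function.comp_apply, orbitExp]
  rw [mul_smul, h2]

theorem piCoe_mul (U V : ∀ i, SU (d i)) : piCoe (U * V) = piCoe U * piCoe V := rfl

theorem tensorConj_one (B : Matrix (Idx d) (Idx d) ℂ) :
    tensorConj (piCoe (1 : ∀ i, SU (d i))) B = B := by
  have : tensor (piCoe (1 : ∀ i, SU (d i))) = 1 := tensor_one
  rw [tensorConj_apply, this, one_mul, star_one, mul_one]

/-- Conjugation by a tensor product of unitary matrices. -/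
def tensorConjEquiv (U : ∀ i, SU (d i)) :
    Matrix (Idx d) (Idx d) ℂ ≃L[ℝ] Matrix (Idx d) (Idx d) ℂ :=
  ContinuousLinearEquiv.equivOfInverse (tensorConj (piCoe U)) (tensorConj (piCoe U⁻¹))
    (fun B => by
      rw [← ContinuousLinearMap.comp_apply, ← tensorConj_mul, ← piCoe_mul, inv_mul_cancel,
        tensorConj_one])
    (fun B => by
      rw [← ContinuousLinearMap.comp_apply, ← tensorConj_mul, ← piCoe_mul, mul_inv_cancel,
        tensorConj_one])

/-- One parametrization at the base point is carried around the orbit by the group, which keeps its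
dimension the same at all points. -/
theorem exists_orbitHasDim (hd : ∀ i, 1 ≤ d i) (W : State d) : ∃ n : ℕ, OrbitHasDim W n := by
  let x₀ : Orbit W := ⟨W, MulAction.mem_orbit_self W⟩
  obtain ⟨n, -, q, hq⟩ := exists_isParamAt_orbit hd x₀
  have := pi_isPretransitive hd W
  choose g hg using fun x : Orbit W => MulAction.exists_smul_eq (∀ i, SU (d i)) x₀ x
  obtain ⟨s, hs, -⟩ := exists_smoothStructure (isEmbedding_orbitIncl W)
      (q := fun x => Homeomorph.smul (g x) ∘ q) fun x => by
    have h := hq.smul (Homeomorph.smul (g x)) (tensorConjEquiv (g x))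
      fun z => orbitIncl_smul (g x) z
    rwa [Homeomorph.smul_apply, hg x] at h
  exact ⟨n, s, hs⟩

theorem orbitHasDim_le (hd : ∀ i, 1 ≤ d i) {W : State d} {n : ℕ} (h : OrbitHasDim W n) :
    n ≤ (∑ i, d i ^ 2) - k := by
  obtain ⟨s, hs⟩ := h
  obtain ⟨m, hm, q, hq⟩ := exists_isParamAt_orbit hd (⟨W, MulAction.mem_orbit_self W⟩ : Orbit W)
  exact (hs.le_finrank hq).trans (by rwa [finrank_euclideanSpace_fin])

/-! ### Generic orbits -/

/-- The center is normal, lies in every isotropy group and equals one of them, so conjugation in the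
definition of genericity has no effect. -/
theorem isGeneric_iff (hk : 2 ≤ k) (hd : ∀ i, 2 ≤ d i) {W : State d} :
    IsGeneric W ↔ MulAction.stabilizer (localUnitaryGroup d) W =
      Subgroup.center (localUnitaryGroup d) := by
  have hd1 : ∀ i, 1 ≤ d i := fun i => by have := hd i; omega
  constructor
  · intro h
    obtain ⟨W₀, hW₀⟩ := exists_state_stabilizer_eq_center hk hd
    obtain ⟨g, hg⟩ := h W₀
    refine le_antisymm (fun a ha => ?_) (center_le_stabilizer hd1 W)
    have h1 : g * a * g⁻¹ ∈ Subgroup.center (localUnitaryGroup d) := by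
      rw [← hW₀]
      exact hg ⟨a, ha, rfl⟩
    simpa [mul_assoc] using Subgroup.instNormalCenter.conj_mem _ h1 g⁻¹
  · intro h V
    refine ⟨1, ?_⟩
    rintro _ ⟨a, ha, rfl⟩
    rw [h] at ha
    simpa using center_le_stabilizer hd1 V ha

/-- Isotropy groups along an orbit are conjugate, and the center is stable under conjugation, so the
base point is immaterial. -/
theorem pi_smul_eq_self_iff (hk : 2 ≤ k) (hd : ∀ i, 2 ≤ d i) {W : State d} (hW : IsGeneric W)
    {x : Orbit W} {U : ∀ i, SU (d i)} :
    U • x = x ↔ ∀ i, U i ∈ Subgroup.center (SU (d i)) := by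
  have hd1 : ∀ i, 1 ≤ d i := fun i => by have := hd i; omega
  have hx : U • x = x ↔ localSU d U ∈ MulAction.stabilizer (localUnitaryGroup d) (x : State d) := by
    rw [MulAction.mem_stabilizer_iff, ← coe_pi_smul, Subtype.ext_iff]
  rw [hx]
  constructor
  · intro h i
    obtain ⟨_, g, rfl⟩ := x
    have h1 : g⁻¹ * localSU d U * g ∈ Subgroup.center (localUnitaryGroup d) := by
      rw [← (isGeneric_iff hk hd).1 hW, MulAction.mem_stabilizer_iff, mul_smul, mul_smul,
        inv_smul_eq_iff]
      exact h
    have h2 : localSU d U ∈ Subgroup.center (localUnitaryGroup d) := by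
      simpa [mul_assoc] using Subgroup.instNormalCenter.conj_mem _ h1 g
    exact (mem_center_SU_iff (hd1 i)).2 (exists_smul_one_of_mem_center hd1 h2 i)
  · intro h
    choose c hc using fun i => (mem_center_SU_iff (hd1 i)).1 (h i)
    exact center_le_stabilizer hd1 _ (mem_center_of_eq_smul_one (tensor_eq_smul_one hc))

theorem isParamAt_genericOrbit (hk : 2 ≤ k) (hd : ∀ i, 2 ≤ d i) {W : State d} (hW : IsGeneric W)
    (x : Orbit W) : IsParamAt (orbitIncl W) (orbitExp x) x := by
  have hd1 : ∀ i, 1 ≤ d i := fun i => by have := hd i; omega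
  refine ⟨?_, by simp [orbitExp, piExp_zero], contDiff_orbitExp x, ?_⟩
  · rw [show orbitExp x = (fun U : ∀ i, SU (d i) => U • x) ∘ piExp from rfl, ← Filter.map_map,
      map_piExp_nhds, map_smul_nhds hd1]
  · rw [injective_iff_map_eq_zero]
    intro A hA
    funext i
    refine eq_zero_of_suExp_mem_center (hd1 i) fun t => ?_
    exact (pi_smul_eq_self_iff hk hd hW).1 (orbitExp_eq_of_fderiv_eq_zero hA t) i

/-- A generic orbit is parametrized by the product of the groups `SU(d i) / Z_{d i}`. -/
theorem exists_pi_PSU_equiv (hk : 2 ≤ k) (hd : ∀ i, 2 ≤ d i) {W : State d} (hW : IsGeneric W)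
    (x₀ : Orbit W) : ∃ F : (∀ i, PSU (d i)) ≃ Orbit W,
      ∀ U : ∀ i, SU (d i), F (fun i => QuotientGroup.mk (U i)) = U • x₀ := by
  have := pi_isPretransitive (fun i => by have := hd i; omega) W
  have heq : ∀ U V : ∀ i, SU (d i), U • x₀ = V • x₀ ↔
      ∀ i, (QuotientGroup.mk (U i) : PSU (d i)) = QuotientGroup.mk (V i) := fun U V => by
    simp only [QuotientGroup.eq]
    rw [eq_comm, ← inv_smul_eq_iff, ← mul_smul, pi_smul_eq_self_iff hk hd hW]
    rfl
  -- Representatives are chosen arbitrarily; `heq` shows that the result does not depend on them.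
  let Ψ : (∀ i, PSU (d i)) → Orbit W := fun y => (fun i => (y i).out) • x₀
  have hΨ : ∀ U : ∀ i, SU (d i), Ψ (fun i => QuotientGroup.mk (U i)) = U • x₀ := fun U =>
    (heq _ _).2 fun i => QuotientGroup.out_eq' _
  refine ⟨Equiv.ofBijective Ψ ⟨fun y z h => ?_, fun x => ?_⟩, hΨ⟩
  · funext i
    rw [← QuotientGroup.out_eq' (y i), ← QuotientGroup.out_eq' (z i)]
    exact (heq _ _).1 h i
  · obtain ⟨U, hU⟩ := MulAction.exists_smul_eq (∀ i, SU (d i)) x₀ x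
    exact ⟨_, (hΨ U).trans hU⟩

/-- The bijection with the product of quotients is equivariant, so in exponential coordinates it is
the linear map `L` at every point. -/
theorem exists_genericOrbit_diffeomorphic (hk : 2 ≤ k) (hd : ∀ i, 2 ≤ d i) {W : State d}
    (hW : IsGeneric W) {Q : ∀ i, SmoothStructure (d i ^ 2 - 1) (PSU (d i))}
    (hQ : ∀ i, (Q i).IsParametrized fun x v => QuotientGroup.mk
      (suExp (suEquiv (one_le_two.trans (hd i)) v)) * x) :
    ∃ s : SmoothStructure ((∑ i, d i ^ 2) - k) (Orbit W),
      s.IsEmbedded (orbitIncl W) ∧ DiffeomorphicToProd s Q := by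
  have hd1 : ∀ i, 1 ≤ d i := fun i => one_le_two.trans (hd i)
  let E : (∀ i, EuclideanSpace ℝ (Fin (d i ^ 2 - 1))) ≃L[ℝ] ∀ i, su (d i) :=
    ContinuousLinearEquiv.piCongrRight fun i => suEquiv (hd1 i)
  let L : EuclideanSpace ℝ (Fin ((∑ i, d i ^ 2) - k)) ≃L[ℝ]
      ∀ i, EuclideanSpace ℝ (Fin (d i ^ 2 - 1)) := ContinuousLinearEquiv.ofFinrankEq (by
    rw [E.toLinearEquiv.finrank_eq, finrank_pi_su hd1, finrank_euclideanSpace_fin])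
  obtain ⟨s, hs, hsp⟩ := exists_smoothStructure (isEmbedding_orbitIncl W) fun x =>
    (isParamAt_genericOrbit hk hd hW x).comp_equiv (L.trans E)
  obtain ⟨F, hF⟩ := exists_pi_PSU_equiv hk hd hW ⟨W, MulAction.mem_orbit_self W⟩
  refine ⟨s, hs, hsp.diffeomorphicToProd hQ F.symm L fun x v => ?_⟩
  obtain ⟨y, rfl⟩ := F.surjective x
  obtain ⟨U, rfl⟩ : ∃ U : ∀ i, SU (d i), (fun i => QuotientGroup.mk (U i)) = y :=
    ⟨fun i => (y i).out, funext fun i => QuotientGroup.out_eq' _⟩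
  rw [Equiv.symm_apply_eq, Equiv.symm_apply_apply, hF]
  change piExp (E (L v)) • U • _ = F fun i => QuotientGroup.mk (piExp (E (L v)) i * U i)
  rw [hF (fun i => piExp (E (L v)) i * U i), ← mul_smul]
  rfl

end OrbitGeometry

end LocalUnitary

end

/-! ### The main theorem -/

theorem theorem2 (k : ℕ) (hk : 2 ≤ k) (d : Fin k → ℕ) (hd : ∀ i, 2 ≤ d i) (hmono : Monotone d) :
    -- every orbit is a submanifold, and the maximum dimension is `d₁² + ⋯ + d_k² - k`
    ((∀ W : LocalUnitary.State d, ∃ n : ℕ, LocalUnitary.OrbitHasDim W n) ∧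
      IsGreatest {n : ℕ | ∃ W : LocalUnitary.State d, LocalUnitary.OrbitHasDim W n}
        ((∑ i, d i ^ 2) - k)) ∧
    -- the minimal isotropy subgroup is the center
    IsLeast
      (Set.range fun W : LocalUnitary.State d =>
        MulAction.stabilizer (LocalUnitary.localUnitaryGroup d) W)
      (Subgroup.center (LocalUnitary.localUnitaryGroup d)) ∧
    -- the center `Z_{d i}` of `SU(d i)` is cyclic of order `d i`
    (∀ i, IsCyclic (Subgroup.center (LocalUnitary.SU (d i))) ∧
      Nat.card (Subgroup.center (LocalUnitary.SU (d i))) = d i) ∧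
    -- generic orbits are diffeomorphic to the product of the `SU(d i) / Z_{d i}`
    (∃ Q : ∀ i, LocalUnitary.SmoothStructure (d i ^ 2 - 1) (LocalUnitary.PSU (d i)),
      (∀ i, LocalUnitary.IsQuotientStructure (Q i)) ∧
      ∀ W : LocalUnitary.State d, LocalUnitary.IsGeneric W →
        ∃ s : LocalUnitary.SmoothStructure ((∑ i, d i ^ 2) - k) (LocalUnitary.Orbit W),
          s.IsEmbedded (LocalUnitary.orbitIncl W) ∧
            LocalUnitary.DiffeomorphicToProd s Q) := by
  have hd1 : ∀ i, 1 ≤ d i := fun i => one_le_two.trans (hd i)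
  choose Q hQ hQp using fun i => LocalUnitary.exists_quotientStructure (hd1 i)
  obtain ⟨W₀, hW₀⟩ := LocalUnitary.exists_state_stabilizer_eq_center hk hd
  have hgen : ∀ W : LocalUnitary.State d, LocalUnitary.IsGeneric W →
      ∃ s : LocalUnitary.SmoothStructure ((∑ i, d i ^ 2) - k) (LocalUnitary.Orbit W),
        s.IsEmbedded (LocalUnitary.orbitIncl W) ∧ LocalUnitary.DiffeomorphicToProd s Q :=
    fun W hW => LocalUnitary.exists_genericOrbit_diffeomorphic hk hd hW hQp
  refine ⟨⟨LocalUnitary.exists_orbitHasDim hd1, ?_, ?_⟩, ⟨⟨W₀, hW₀⟩, ?_⟩,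
    fun i => LocalUnitary.isCyclic_center_SU (hd1 i), Q, hQ, hgen⟩
  -- The maximum is attained on the generic orbit of the witness state.
  · obtain ⟨s, hs, -⟩ := hgen W₀ ((LocalUnitary.isGeneric_iff hk hd).2 hW₀)
    exact ⟨W₀, s, hs⟩
  · rintro n ⟨W, hW⟩
    exact LocalUnitary.orbitHasDim_le hd1 hW
  · rintro _ ⟨W, rfl⟩
    exact LocalUnitary.center_le_stabilizer hd1 W
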